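/- By a Dedekind scheme we mean an irreducible, Noetherian, normal scheme of dimension one; it is Nagata if it is covered by affine opens $\operatorname{Spec} R$ with $R$ a Nagata ring (Noetherian, and for every prime $\mathfrak p$ and every finite field extension $L$ of $\operatorname{Frac}(R/\mathfrak p)$ the integral closure of $R/\mathfrak p$ in $L$ is a finite $R/\mathfrak p$-module). A scheme is normal if all its local rings are integrally closed domains. Let $S$ be a Nagata Dedekind scheme with function field $K$; a subscript $K$ on an $S$-scheme denotes its generic fibre. An $S$-scheme $X$ has the weak extension property if for every smooth $S$-scheme $Z$ and every $K$-morphism $u_K\colon Z_K\to X_K$ there is an $S$-morphism $u\colon Z\to X$ extending $u_K$. A pseudo-Néron model over $S$ of a smooth, separated $K$-scheme $X_K$ of finite type is a separated, flat $S$-scheme $X$ of finite type, with generic fibre identified with $X_K$, that has the weak extension property. Theorem. Let $Y_K$ be a smooth, separated $K$-scheme of finite type that has a normal pseudo-Néron model $Y$ over $S$, and let $X_K$ be a smooth $K$-scheme with a finite $K$-morphism $f\colon X_K\to Y_K$. (1) $X_K$ has a normal pseudo-Néron model over $S$. (2) More precisely, let $X$ be the integral closure (relative normalization) of $Y$ in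 $X_K$ along $X_K\xrightarrow{f} Y_K\to Y$. Then $X\to Y$ is finite, and $X$, with the canonical morphism $X_K\to X$, is a normal pseudo-Néron model of $X_K$ over $S$. (3) If $X'\to Y'$ is any finite morphism of $S$-schemes and $Y'$ has the weak extension property, then so does $X'$. -/

import Mathlib

open CategoryTheory CategoryTheory.Limits AlgebraicGeometry

universe u

/-- A domain `A` is *N-2* (Japanese) if for every finite extension `L` of its fraction field the
integral closure of `A` in `L` is a finite `A`-module. -/
def IsN2Domain (A : Type u) [CommRing A] [IsDomain A] : Prop :=
  ∀ (L : Type u) [Field L] [Algebra A L] [Algebra (FractionRing A) L]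
    [IsScalarTower A (FractionRing A) L] [FiniteDimensional (FractionRing A) L],
    Module.Finite A (integralClosure A L)

/-- A *Nagata ring*: a Noetherian ring all of whose quotient domains are N-2. -/
def IsNagataRing (A : Type u) [CommRing A] : Prop :=
  IsNoetherianRing A ∧ ∀ (p : Ideal A) [p.IsPrime], IsN2Domain (A ⧸ p)

/-- A *Nagata scheme*: every point has an affine open neighbourhood whose ring is Nagata. -/
def IsNagataScheme (S : Scheme.{u}) : Prop :=
  ∀ s : S, ∃ U : S.Opens, IsAffineOpen U ∧ s ∈ U ∧ IsNagataRing Γ(S, U)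

/-- A *normal scheme*: all local rings are integrally closed domains. -/
def IsNormalScheme (X : Scheme.{u}) : Prop :=
  ∀ x : X, IsDomain (X.presheaf.stalk x) ∧ IsIntegrallyClosed (X.presheaf.stalk x)

/-- A *Dedekind scheme*: an irreducible, Noetherian, normal scheme of dimension one. -/
class IsDedekindScheme (S : Scheme.{u}) : Prop extends IsNoetherian S, IrreducibleSpace S where
  normal : IsNormalScheme S
  dim_eq_one : topologicalKrullDim S = 1

/-- The inclusion `Spec K ⟶ S` of the generic point of an irreducible scheme, where `K` is the
function field of `S`. -/
noncomputable abbrev genericPointHom (S : Scheme.{u}) [IrreducibleSpace S] :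
    Spec S.functionField ⟶ S :=
  S.fromSpecStalk (genericPoint S)

/-- The *weak extension property* of an `S`-scheme `p : X ⟶ S`: for every smooth `S`-scheme `Z`,
every `K`-morphism `Z_K ⟶ X_K` of generic fibres extends to some `S`-morphism `Z ⟶ X`. -/
def WeakExtensionProperty {S X : Scheme.{u}} [IrreducibleSpace S] (p : X ⟶ S) : Prop :=
  ∀ (Z : Scheme.{u}) (q : Z ⟶ S) [Smooth q]
    (uK : pullback q (genericPointHom S) ⟶ pullback p (genericPointHom S)),
    uK ≫ pullback.snd p (genericPointHom S) = pullback.snd q (genericPointHom S) →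
    ∃ u : Z ⟶ X, u ≫ p = q ∧
      pullback.fst q (genericPointHom S) ≫ u = uK ≫ pullback.fst p (genericPointHom S)

/-- `p : X ⟶ S`, together with `j : X_K ⟶ X`, is a *pseudo-Néron model* of the smooth separated
`K`-scheme of finite type `a : X_K ⟶ Spec K`: it is separated, flat and of finite type over `S`,
`j` identifies `X_K` with its generic fibre, and it has the weak extension property. -/
structure IsPseudoNeronModel {S XK X : Scheme.{u}} [IrreducibleSpace S]
    (a : XK ⟶ Spec S.functionField) (p : X ⟶ S) (j : XK ⟶ X) : Prop where
  smooth_generic : Smooth a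
  isSeparated_generic : IsSeparated a
  quasiCompact_generic : QuasiCompact a
  isSeparated : IsSeparated p
  flat : Flat p
  locallyOfFiniteType : LocallyOfFiniteType p
  quasiCompact : QuasiCompact p
  isPullback : IsPullback j a p (genericPointHom S)
  weakExtension : WeakExtensionProperty p

/-- A *normal pseudo-Néron model*: a pseudo-Néron model which is a normal scheme. -/
structure IsNormalPseudoNeronModel {S XK X : Scheme.{u}} [IrreducibleSpace S]
    (a : XK ⟶ Spec S.functionField) (p : X ⟶ S) (j : XK ⟶ X) : Prop
    extends IsPseudoNeronModel a p j where
  normal : IsNormalScheme X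

/-! For (3), the point is that a smooth `Z` over `S` is integrally closed in `Z_K`: this holds for
`S` in `Spec K` because `S` is normal, and integral closure commutes with smooth base change.
Compose `u_K` with `X' ⟶ Y'` and extend the result to `v : Z ⟶ Y'`. The integral morphism `X' ×_{Y'}
Z ⟶ Z` then has a section over `Z_K`, and the universal property of relative normalization extends
it to all of `Z`.

For (2), which gives (1), work over an affine open of `S` with N-2 Dedekind ring `R`. Let `A` be of
finite type over `R`, `B` finite over the generic fibre of `A` and normal because `X_K` is smooth
over `K`, and `C` the integral closure of `A` in `B`. Clearing denominators shows that `B` is the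
generic fibre of `C`; `C` is flat because it is torsion-free over a Dedekind domain, normal because
it is integrally closed in the normal ring `B`, and (3) supplies the weak extension property.

The substantial claim is that `C` is finite over `A`. Since `B` is reduced, it embeds in the product
of the residue fields at its minimal primes, so one may take `A` to be a domain `D` and `B` a field
`L`. Near each prime of `D`, Noether normalization of a fibre together with Zariski's main theorem
compares `D` with a polynomial ring over `R`. For polynomial rings the only obstacle is
inseparability of the field extension, removed by adjoining `q ^ n`-th roots of the variables and of
finitely many constants. -/

/-! ### Polynomial rings over N-2 domains -/

/-- An algebraic, essentially finitely generated field extension is finite. This form of N-2 spares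
later uses from fixing a `FractionRing A`-algebra structure on `L`. -/
theorem IsN2Domain.finite_integralClosure {A L : Type u} [CommRing A] [IsDomain A] (h : IsN2Domain A)
    [Field L] [Algebra A L] [FaithfulSMul A L] [Algebra.IsAlgebraic A L]
    [Algebra.EssFiniteType A L] : Module.Finite A (integralClosure A L) := by
  let _ : Algebra (FractionRing A) L := FractionRing.liftAlgebra A L
  have : IsScalarTower A (FractionRing A) L := FractionRing.isScalarTower_liftAlgebra A L
  have : Algebra.EssFiniteType (FractionRing A) L := .of_comp A (FractionRing A) L
  have : Algebra.IsAlgebraic (FractionRing A) L := .extendScalars (IsFractionRing.injective A _)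
  have : FiniteDimensional (FractionRing A) L := Algebra.finite_of_essFiniteType_of_isAlgebraic
  exact h L

instance MvPolynomial.isIntegrallyClosed_fin {R : Type*} [CommRing R] [IsDomain R]
    [IsIntegrallyClosed R] (d : ℕ) : IsIntegrallyClosed (MvPolynomial (Fin d) R) := by
  induction d with
  | zero => exact .of_equiv (MvPolynomial.isEmptyRingEquiv R (Fin 0)).symm
  | succ d ih => exact .of_equiv (MvPolynomial.finSuccEquiv R d).symm.toRingEquiv

/-- If `y ^ q ^ n` is separable over `F` and the coefficients of its minimal polynomial have
`q ^ n`-th roots in `F'`, then `y` is separable over `F'`. -/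
theorem IsSeparable.of_pow_expChar_pow {F F' Ω : Type*} [Field F] [Field F'] [Field Ω] [Algebra F F']
    [Algebra F' Ω] [Algebra F Ω] [IsScalarTower F F' Ω] (q : ℕ) [ExpChar F' q] (n : ℕ) (y : Ω)
    (hy : IsSeparable F (y ^ q ^ n))
    (H : ∀ i, ∃ c : F', c ^ q ^ n = algebraMap F F' ((minpoly F (y ^ q ^ n)).coeff i)) :
    IsSeparable F' y := by
  have : ExpChar Ω q := expChar_of_injective_algebraMap (algebraMap F' Ω).injective q
  set p := minpoly F (y ^ q ^ n)
  -- `h` is the polynomial whose Frobenius twist is `p`, so `h(y) ^ q ^ n = p(y ^ q ^ n) = 0`;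
  -- twisting does not affect separability.
  obtain ⟨h, hh⟩ : ∃ h : Polynomial F', h.map (iterateFrobenius F' q n) = p.map (algebraMap F F') := by
    rw [← Polynomial.mem_lifts, Polynomial.lifts_iff_coeff_lifts]
    intro i
    obtain ⟨c, hc⟩ := H i
    exact ⟨c, by simp [iterateFrobenius_def, hc]⟩
  have hsep : h.Separable := by
    rw [← Polynomial.separable_map (iterateFrobenius F' q n), hh, Polynomial.separable_map]
    exact hy
  refine hsep.of_dvd (minpoly.dvd _ _ ?_)
  have h0 : iterateFrobenius Ω q n (Polynomial.aeval y h) = 0 := by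
    have h1 : (iterateFrobenius Ω q n).comp (algebraMap F' Ω) =
        (algebraMap F' Ω).comp (iterateFrobenius F' q n) := by
      ext x; simp [iterateFrobenius_def]
    rw [Polynomial.aeval_def, Polynomial.hom_eval₂, h1, ← Polynomial.eval₂_map, hh,
      Polynomial.eval₂_map, ← IsScalarTower.algebraMap_eq, iterateFrobenius_def]
    exact minpoly.aeval F (y ^ q ^ n)
  exact (map_eq_zero_iff _ (iterateFrobenius Ω q n).injective).mp h0

/-- A finite subset of a field extension can be made separable by raising its elements to a common
power of the exponential characteristic. -/
theorem Finset.exists_forall_isSeparable_pow {F Ω : Type*} [Field F] [Field Ω] [Algebra F Ω]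
    [Algebra.IsAlgebraic F Ω] (q : ℕ) [ExpChar F q] (s : Finset Ω) :
    ∃ n : ℕ, ∀ y ∈ s, IsSeparable F (y ^ q ^ n) := by
  have key : ∀ y : Ω, ∃ n : ℕ, IsSeparable F (y ^ q ^ n) := by
    intro y
    have := separableClosure.isPurelyInseparable F Ω
    have : ExpChar (separableClosure F Ω) q :=
      expChar_of_injective_algebraMap (algebraMap F _).injective q
    obtain ⟨n, x, hx⟩ := IsPurelyInseparable.pow_mem (separableClosure F Ω) q y
    exact ⟨n, mem_separableClosure_iff.mp (hx ▸ x.2)⟩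
  choose n hn using key
  refine ⟨s.sup n, fun y hy => ?_⟩
  obtain ⟨k, hk⟩ := Nat.exists_eq_add_of_le (Finset.le_sup (f := n) hy)
  rw [hk, pow_add, pow_mul, ← mem_separableClosure_iff]
  exact pow_mem (mem_separableClosure_iff.mpr (hn y)) _

/-- A finite set of elements of an integrally closed N-2 domain acquires `Q`-th roots in a finite
integrally closed extension. -/
theorem IsN2Domain.exists_finite_subalgebra_roots {R Ω : Type u} [CommRing R] [IsDomain R]
    (h : IsN2Domain R) [Field Ω] [IsAlgClosed Ω] [Algebra R Ω] [FaithfulSMul R Ω] {Q : ℕ}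
    (hQ : 0 < Q) {T : Set R} (hT : T.Finite) :
    ∃ R' : Subalgebra R Ω, Module.Finite R R' ∧ IsIntegrallyClosed R' ∧
      ∀ r ∈ T, ∃ c : R', c ^ Q = algebraMap R R' r := by
  let _ : Algebra (FractionRing R) Ω := FractionRing.liftAlgebra R Ω
  have : IsScalarTower R (FractionRing R) Ω := FractionRing.isScalarTower_liftAlgebra R Ω
  have hroot : ∀ r : R, ∃ z : Ω, z ^ Q = algebraMap R Ω r := fun r =>
    IsAlgClosed.exists_pow_nat_eq _ hQ
  choose ρ hρ using hroot
  have hint : ∀ r, IsIntegral R (ρ r) := fun r =>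
    IsIntegral.of_pow hQ (hρ r ▸ isIntegral_algebraMap)
  let K' := IntermediateField.adjoin (FractionRing R) (ρ '' T)
  have : Finite (ρ '' T) := (hT.image ρ).to_subtype
  have : FiniteDimensional (FractionRing R) K' :=
    IntermediateField.finiteDimensional_adjoin fun x hx => by
      obtain ⟨r, -, rfl⟩ := hx
      exact (hint r).tower_top
  let φ : K' →ₐ[R] Ω := (K'.val).restrictScalars R
  have hφ : Function.Injective φ := Subtype.val_injective
  -- Finiteness of `R'` is exactly N-2 for `K'`; the subalgebra below is the image of this integral
  -- closure in `Ω`.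
  have hfin : Module.Finite R (integralClosure R K') := h K'
  have : IsIntegrallyClosed (integralClosure R K') :=
    integralClosure.isIntegrallyClosedOfFiniteExtension (FractionRing R)
  let e := (integralClosure R K').equivMapOfInjective φ hφ
  refine ⟨(integralClosure R K').map φ, .equiv e.toLinearEquiv, .of_equiv e.toRingEquiv, ?_⟩
  intro r hr
  have hmem : ρ r ∈ K' := IntermediateField.subset_adjoin _ _ ⟨r, hr, rfl⟩
  refine ⟨⟨ρ r, ⟨ρ r, hmem⟩, ?_, rfl⟩, Subtype.ext (hρ r)⟩
  exact (isIntegral_algHom_iff φ hφ).mp (hint r)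

/-- Taking `q ^ n`-th roots of algebraically independent elements keeps them algebraically
independent, also over an integral extension. -/
theorem AlgebraicIndependent.of_pow_expChar_pow {ι R R' Ω : Type*} [CommRing R] [CommRing R']
    [IsDomain R'] [Field Ω] [Algebra R R'] [Algebra R' Ω] [Algebra R Ω] [IsScalarTower R R' Ω]
    [FaithfulSMul R' Ω]
    [Algebra.IsIntegral R R'] (q n : ℕ) [ExpChar Ω q] (s : ι → Ω)
    (hs : AlgebraicIndependent R fun i => s i ^ q ^ n) : AlgebraicIndependent R' s := by
  have : ExpChar R' q :=
    (algebraMap R' Ω).expChar (FaithfulSMul.algebraMap_injective R' Ω) q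
  have hs' := hs.extendScalars_of_isIntegral R'
  rw [algebraicIndependent_iff] at hs' ⊢
  intro p hp
  have h1 : (iterateFrobenius Ω q n).comp (algebraMap R' Ω) =
      (algebraMap R' Ω).comp (iterateFrobenius R' q n) := by
    ext x; simp [iterateFrobenius_def]
  -- Frobenius turns a relation among the `s i` into one among the `s i ^ q ^ n`, with twisted
  -- coefficients.
  have h2 := congrArg (iterateFrobenius Ω q n) hp
  rw [MvPolynomial.aeval_def, map_zero, MvPolynomial.eval₂_comp_left, h1,
    ← MvPolynomial.eval₂_map] at h2
  have h3 := hs' (MvPolynomial.map (iterateFrobenius R' q n) p) h2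
  exact MvPolynomial.map_injective _ (iterateFrobenius_inj R' q n) (h3.trans (map_zero _).symm)

/-- Polynomials whose coefficients have `q ^ n`-th roots have `q ^ n`-th roots after extracting
roots of the variables. -/
theorem MvPolynomial.exists_aeval_pow_eq {ι R R' Ω : Type*} [CommRing R] [CommRing R'] [Field Ω]
    [Algebra R R'] [Algebra R' Ω] [Algebra R Ω] [IsScalarTower R R' Ω] (q n : ℕ) [ExpChar Ω q]
    (s : ι → Ω) (a : MvPolynomial ι R)
    (ha : ∀ m, ∃ c : R', c ^ q ^ n = algebraMap R R' (a.coeff m)) :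
    ∃ a' : MvPolynomial ι R',
      aeval s a' ^ q ^ n = aeval (fun i => s i ^ q ^ n) a := by
  choose c hc using ha
  refine ⟨∑ m ∈ a.support, monomial m (c m), ?_⟩
  rw [map_sum, sum_pow_char_pow]
  conv_rhs => rw [← a.support_sum_monomial_coeff, map_sum]
  refine Finset.sum_congr rfl fun m _ => ?_
  rw [aeval_monomial, aeval_monomial, mul_pow, ← map_pow, hc,
    ← IsScalarTower.algebraMap_apply, Finsupp.prod, Finsupp.prod, ← Finset.prod_pow]
  simp only [← pow_mul, mul_comm]

theorem exists_pow_eq_algebraMap_div {P P' E E' Ω : Type*} [CommRing P] [CommRing P'] [Field E]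
    [Field E'] [Field Ω] [Algebra P E] [Algebra P' E'] [Algebra E E'] [Algebra P Ω] [Algebra P' Ω]
    [Algebra E Ω] [Algebra E' Ω] [IsScalarTower P E Ω] [IsScalarTower P' E' Ω]
    [IsScalarTower E E' Ω] {Q : ℕ} {a b : P}
    (ha : ∃ a' : P', algebraMap P' Ω a' ^ Q = algebraMap P Ω a)
    (hb : ∃ b' : P', algebraMap P' Ω b' ^ Q = algebraMap P Ω b) :
    ∃ c : E', c ^ Q = algebraMap E E' (algebraMap P E a / algebraMap P E b) := by
  obtain ⟨a', ha⟩ := ha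
  obtain ⟨b', hb⟩ := hb
  refine ⟨algebraMap P' E' a' / algebraMap P' E' b', (algebraMap E' Ω).injective ?_⟩
  rw [map_pow, map_div₀, ← IsScalarTower.algebraMap_apply, ← IsScalarTower.algebraMap_apply,
    ← IsScalarTower.algebraMap_apply, div_pow, ha, hb, map_div₀, ← IsScalarTower.algebraMap_apply,
    ← IsScalarTower.algebraMap_apply]

/-- Let `E ⊆ L` be a finite extension of `Frac P`, and `P'` a finite integrally closed extension of
`P`. If `L` is generated by elements whose `q ^ n`-th powers are separable with minimal polynomials
having `q ^ n`-th roots of their coefficients in `Frac P'`, then the integral closure of `P` in `L`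
is finite. -/
theorem finite_integralClosure_of_exists_roots {P P' E E' L Ω : Type*} [CommRing P]
    [IsNoetherianRing P] [CommRing P'] [IsDomain P'] [IsIntegrallyClosed P'] [Algebra P P']
    [Module.Finite P P'] [Field E] [Algebra P E] [Field E'] [Algebra P' E'] [IsFractionRing P' E']
    [Field L] [Algebra P L] [Algebra E L] [IsScalarTower P E L] [Field Ω] [Algebra L Ω]
    [Algebra E Ω] [Algebra P Ω] [Algebra P' Ω] [Algebra E' Ω] [Algebra E E'] [Algebra P E']
    [IsScalarTower P L Ω] [IsScalarTower E L Ω] [IsScalarTower P P' E'] [IsScalarTower P' E' Ω]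
    [IsScalarTower P E' Ω] [IsScalarTower P P' Ω] [IsScalarTower E E' Ω]
    (q n : ℕ) [ExpChar Ω q] (s₀ : Finset L) (hs₀ : Submodule.span E (s₀ : Set L) = ⊤)
    (hn : ∀ y ∈ s₀, IsSeparable E (algebraMap L Ω y ^ q ^ n))
    (hroot : ∀ y ∈ s₀, ∀ i, ∃ c : E',
      c ^ q ^ n = algebraMap E E' ((minpoly E (algebraMap L Ω y ^ q ^ n)).coeff i)) :
    Module.Finite P (integralClosure P L) := by
  have : ExpChar E' q := (algebraMap E' Ω).expChar (algebraMap E' Ω).injective q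
  have : IsNoetherianRing P' := isNoetherian_of_isNoetherianRing_of_finite P P' |> fun _ =>
    isNoetherian_of_tower P inferInstance
  have hsep : ∀ y ∈ algebraMap L Ω '' s₀, IsSeparable E' y := by
    rintro _ ⟨y, hy, rfl⟩
    exact IsSeparable.of_pow_expChar_pow q n _ (hn y hy) (hroot y hy)
  let M := IntermediateField.adjoin E' (algebraMap L Ω '' s₀)
  have : FiniteDimensional E' M :=
    IntermediateField.finiteDimensional_adjoin fun y hy => (hsep y hy).isIntegral
  have : Algebra.IsSeparable E' M :=
    (IntermediateField.isSeparable_adjoin_iff_isSeparable E' Ω).mpr hsep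
  have : IsScalarTower P P' M :=
    .of_algebraMap_eq fun x => Subtype.ext (IsScalarTower.algebraMap_apply P P' Ω x)
  -- The classical finiteness theorem for separable extensions of an integrally closed Noetherian
  -- domain. The rest embeds the integral closure of `P` in `L` into this finite module over the
  -- Noetherian ring `P`.
  have hMfin : Module.Finite P' (integralClosure P' M) :=
    IsIntegralClosure.finite P' E' M (integralClosure P' M)
  have : Module.Finite P (integralClosure P' M) := .trans P' _
  let g : integralClosure P' M →ₗ[P] Ω :=
    (M.val.restrictScalars P).toLinearMap.comp
      ((integralClosure P' M).val.restrictScalars P).toLinearMap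
  let f : integralClosure P L →ₗ[P] Ω :=
    (IsScalarTower.toAlgHom P L Ω).toLinearMap.comp (integralClosure P L).val.toLinearMap
  have hf : Function.Injective f := (algebraMap L Ω).injective.comp Subtype.val_injective
  have hLM : ∀ x : L, algebraMap L Ω x ∈ M := by
    intro x
    have hx : x ∈ Submodule.span E (s₀ : Set L) := hs₀ ▸ Submodule.mem_top
    induction hx using Submodule.span_induction with
    | mem x hx =>
      exact IntermediateField.subset_adjoin _ _ (Set.mem_image_of_mem _ hx)
    | zero => rw [map_zero]; exact zero_mem _
    | add x y _ _ hx hy => rw [map_add]; exact add_mem hx hy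
    | smul e x _ hx =>
      rw [Algebra.smul_def, map_mul, ← IsScalarTower.algebraMap_apply,
        IsScalarTower.algebraMap_apply E E' Ω]
      exact mul_mem (M.algebraMap_mem _) hx
  have hfg : ∀ x, f x ∈ LinearMap.range g := by
    intro x
    have hx : IsIntegral P (f x) := x.2.map (IsScalarTower.toAlgHom P L Ω)
    exact ⟨⟨⟨f x, hLM x⟩, (isIntegral_algHom_iff (M.val.restrictScalars P')
      Subtype.val_injective).mp hx.tower_top⟩, rfl⟩
  exact Module.Finite.of_injective (f.codRestrict (LinearMap.range g) hfg)
    fun a b hab => hf (congrArg Subtype.val hab)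

/-- Some power `q ^ n` makes the generators of `L` separable over `E`. Only finitely many elements
of `R` occur in their minimal polynomials. Adjoining `q ^ n`-th roots of these to `R` gives `R'`,
and adjoining those of the variables gives a polynomial ring `P'` over `R'`, finite over `P` and
integrally closed; over its fraction field the generators themselves become separable. -/
theorem IsN2Domain.finite_integralClosure_mvPolynomial {R : Type u} [CommRing R] [IsDomain R] [IsNoetherianRing R]
    [IsIntegrallyClosed R] (h : IsN2Domain R) {d : ℕ} (E L : Type u) [Field E] [Field L]
    [Algebra (MvPolynomial (Fin d) R) E] [IsFractionRing (MvPolynomial (Fin d) R) E]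
    [Algebra (MvPolynomial (Fin d) R) L] [Algebra E L]
    [IsScalarTower (MvPolynomial (Fin d) R) E L] [FiniteDimensional E L] :
    Module.Finite (MvPolynomial (Fin d) R) (integralClosure (MvPolynomial (Fin d) R) L) := by
  let P := MvPolynomial (Fin d) R
  let Ω := AlgebraicClosure L
  have hPL : Function.Injective (algebraMap P L) := by
    rw [IsScalarTower.algebraMap_eq P E L]
    exact (algebraMap E L).injective.comp (IsFractionRing.injective P E)
  have hPΩ : Function.Injective (algebraMap P Ω) := by
    rw [IsScalarTower.algebraMap_eq P L Ω]
    exact (algebraMap L Ω).injective.comp hPL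
  let _ : Algebra R Ω := ((algebraMap P Ω).comp (algebraMap R P)).toAlgebra
  have : IsScalarTower R P Ω := .of_algebraMap_eq' rfl
  have hRΩ : Function.Injective (algebraMap R Ω) := hPΩ.comp (MvPolynomial.C_injective _ _)
  have : FaithfulSMul R Ω := (faithfulSMul_iff_algebraMap_injective _ _).mpr hRΩ
  -- In characteristic zero `q = 1`, and all the root extractions below are trivial.
  obtain ⟨q, hq⟩ := ExpChar.exists R
  have : ExpChar E q := expChar_of_injective_ringHom (f := (algebraMap P E).comp MvPolynomial.C)
    ((IsFractionRing.injective P E).comp (MvPolynomial.C_injective _ _)) q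
  have : ExpChar Ω q := expChar_of_injective_ringHom hRΩ q
  have : Algebra.IsAlgebraic E Ω := Algebra.IsAlgebraic.trans E L Ω
  obtain ⟨s₀, hs₀⟩ := (Module.finite_def (R := E) (M := L)).mp inferInstance
  classical
  let Y : Finset Ω := s₀.image (algebraMap L Ω)
  obtain ⟨n, hn⟩ := Y.exists_forall_isSeparable_pow (F := E) q
  have hQ : 0 < q ^ n := pow_pos (expChar_pos R q) n
  -- the finitely many polynomials that need roots
  choose num den hden hnd using fun e : E => IsFractionRing.div_surjective (A := P) e
  let W : Finset E := Y.biUnion fun y => (minpoly E (y ^ q ^ n)).coeffs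
  let T : Set R := ⋃ e ∈ W, ((num e).coeffs ∪ (den e).coeffs : Finset R)
  have hT : T.Finite := W.finite_toSet.biUnion fun _ _ => Finset.finite_toSet _
  obtain ⟨R', hfin, hic, hR'⟩ := h.exists_finite_subalgebra_roots (Ω := Ω) hQ hT
  choose s hs using fun i : Fin d =>
    IsAlgClosed.exists_pow_nat_eq (algebraMap P Ω (MvPolynomial.X i)) hQ
  have haeval : ∀ a : P, MvPolynomial.aeval (fun i => s i ^ q ^ n) a = algebraMap P Ω a := by
    intro a
    have : MvPolynomial.aeval (fun i => s i ^ q ^ n) = IsScalarTower.toAlgHom R P Ω := by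
      ext i
      rw [MvPolynomial.aeval_X]
      exact hs i
    rw [this]; rfl
  have hind : AlgebraicIndependent R' s := by
    refine AlgebraicIndependent.of_pow_expChar_pow (R := R) q n s ?_
    rw [algebraicIndependent_iff]
    intro p hp
    rw [haeval] at hp
    exact (map_eq_zero_iff _ hPΩ).mp hp
  let P' := MvPolynomial (Fin d) R'
  let _ : Algebra P' Ω := (MvPolynomial.aeval (R := R') s).toAlgebra
  have hP'Ω : Function.Injective (algebraMap P' Ω) := hind
  have hP'root : ∀ a : P, (∀ r ∈ a.coeffs, r ∈ T) →
      ∃ a' : P', (algebraMap P' Ω a') ^ q ^ n = algebraMap P Ω a := by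
    intro a ha
    rw [← haeval]
    refine MvPolynomial.exists_aeval_pow_eq q n s a fun m => ?_
    by_cases hm : a.coeff m = 0
    · exact ⟨0, by rw [hm, map_zero, zero_pow hQ.ne']⟩
    · exact hR' _ (ha _ (MvPolynomial.coeff_mem_coeffs m hm))
  -- The variables of `P'` stand for the roots `s i`, so those of `P` map to their `q ^ n`-th
  -- powers.
  let _ : Algebra P P' :=
    (MvPolynomial.aeval (R := R) fun i => (MvPolynomial.X i : P') ^ q ^ n).toAlgebra
  have : IsScalarTower P P' Ω := by
    refine .of_algebraMap_eq fun a => ?_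
    rw [← haeval a]
    have : MvPolynomial.aeval (R := R) (fun i => s i ^ q ^ n) =
        ((MvPolynomial.aeval (R := R') s).restrictScalars R).comp
          (MvPolynomial.aeval fun i => (MvPolynomial.X i : P') ^ q ^ n) := by
      ext i; simp
    rw [this]; rfl
  have : IsScalarTower R P P' := .of_algebraMap_eq fun r =>
    (MvPolynomial.aeval_C _ r).symm
  have : Module.Finite P P' := by
    have : Algebra.FiniteType R P' := .trans (S := R') inferInstance inferInstance
    have : Algebra.FiniteType P P' := .of_restrictScalars_finiteType R P P'
    have : Algebra.IsIntegral P P' := ⟨fun x => by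
      induction x using MvPolynomial.induction_on with
      | C r =>
        exact ((Algebra.IsIntegral.isIntegral (R := R) r).map
          (Algebra.ofId R' P' |>.restrictScalars R)).tower_top
      | add a b ha hb => exact ha.add hb
      | mul_X a i ha =>
        refine ha.mul (IsIntegral.of_pow hQ ?_)
        have hX : algebraMap P P' (MvPolynomial.X i) = (MvPolynomial.X i : P') ^ q ^ n :=
          MvPolynomial.aeval_X (fun i => (MvPolynomial.X i : P') ^ q ^ n) i
        exact hX ▸ isIntegral_algebraMap⟩
    exact Algebra.IsIntegral.finite
  let E' := FractionRing P'
  have : FaithfulSMul P' Ω := (faithfulSMul_iff_algebraMap_injective _ _).mpr hP'Ω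
  let _ : Algebra E' Ω := FractionRing.liftAlgebra P' Ω
  have : IsScalarTower P' E' Ω := FractionRing.isScalarTower_liftAlgebra P' Ω
  have hPP' : Function.Injective (algebraMap P P') := by
    refine Function.Injective.of_comp (f := algebraMap P' Ω) ?_
    rwa [← RingHom.coe_comp, ← IsScalarTower.algebraMap_eq]
  have hPE' : Function.Injective (algebraMap P E') := by
    rw [IsScalarTower.algebraMap_eq P P' E']
    exact (IsFractionRing.injective P' E').comp hPP'
  let _ : Algebra E E' := (IsFractionRing.lift hPE').toAlgebra
  have : IsScalarTower P E E' := .of_algebraMap_eq fun x =>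
    (IsFractionRing.lift_algebraMap hPE' x).symm
  have : IsScalarTower P E' Ω := .to₁₃₄ P P' E' Ω
  have : IsScalarTower E E' Ω := .of_algebraMap_eq' <|
    IsLocalization.ringHom_ext (nonZeroDivisors P) <| by
      rw [RingHom.comp_assoc, ← IsScalarTower.algebraMap_eq P E E',
        ← IsScalarTower.algebraMap_eq P E' Ω, ← IsScalarTower.algebraMap_eq P E Ω]
  refine finite_integralClosure_of_exists_roots (P' := P') (E := E) (E' := E') (Ω := Ω) q n s₀ hs₀
    (fun y hy => hn _ (Finset.mem_image_of_mem _ hy)) fun y hy i => ?_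
  by_cases he0 : (minpoly E (algebraMap L Ω y ^ q ^ n)).coeff i = 0
  · exact ⟨0, by rw [he0, map_zero, zero_pow hQ.ne']⟩
  have heW : (minpoly E (algebraMap L Ω y ^ q ^ n)).coeff i ∈ W :=
    Finset.mem_biUnion.mpr ⟨_, Finset.mem_image_of_mem _ hy, Polynomial.coeff_mem_coeffs he0⟩
  generalize (minpoly E (algebraMap L Ω y ^ q ^ n)).coeff i = e at heW
  rw [← hnd e]
  exact exists_pow_eq_algebraMap_div (E := E) (E' := E') (Ω := Ω)
    (hP'root (num e) fun r hr => Set.mem_biUnion heW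
      (Finset.mem_coe.mpr (Finset.mem_union_left _ hr)))
    (hP'root (den e) fun r hr => Set.mem_biUnion heW
      (Finset.mem_coe.mpr (Finset.mem_union_right _ hr)))

/-- A polynomial ring over a Noetherian integrally closed N-2 domain is N-2. -/
theorem IsN2Domain.mvPolynomial {R : Type u} [CommRing R] [IsDomain R] [IsNoetherianRing R]
    [IsIntegrallyClosed R] (h : IsN2Domain R) (d : ℕ) : IsN2Domain (MvPolynomial (Fin d) R) :=
  fun L _ _ _ _ _ => h.finite_integralClosure_mvPolynomial (FractionRing (MvPolynomial (Fin d) R)) L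

/-! ### Local Noether normalization over a Dedekind domain -/

open TensorProduct in
/-- If the fibre of `D` over `p = P ∩ R` is integral over the fibre of `S`, then `D` is quasi-finite
over `S` at `P`. -/
theorem Algebra.QuasiFiniteAt.of_isIntegral_fiber {R S D : Type*} [CommRing R] [CommRing S] [CommRing D]
    [Algebra R S] [Algebra S D] [Algebra R D] [IsScalarTower R S D] [Algebra.FiniteType S D]
    (P : Ideal D) [P.IsPrime]
    (H : ∀ x : D, (Algebra.TensorProduct.map (AlgHom.id R (P.under R).ResidueField)
      (IsScalarTower.toAlgHom R S D)).toRingHom.IsIntegralElem (1 ⊗ₜ x)) :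
    Algebra.QuasiFiniteAt S P := by
  let Q := P.under S
  let p := P.under R
  have hpQ : p = Q.comap (algebraMap R S) := by
    simp only [p, Q, Ideal.under, Ideal.comap_comap, ← IsScalarTower.algebraMap_eq]
  -- The fibre of `D` over `Q` is a base change of its fibre over `p`, so monic equations push
  -- forward along the compatible maps `hS` and `hD`.
  let θ : p.ResidueField →ₐ[R] Q.ResidueField := Ideal.ResidueField.mapₐ p Q (Algebra.ofId R S) hpQ
  let hS : p.Fiber S →ₐ[R] Q.ResidueField :=
    Algebra.TensorProduct.lift θ (IsScalarTower.toAlgHom R S _) fun _ _ => .all _ _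
  let hD : p.Fiber D →ₐ[R] Q.Fiber D :=
    Algebra.TensorProduct.lift ((IsScalarTower.toAlgHom R Q.ResidueField (Q.Fiber D)).comp θ)
      ((Algebra.TensorProduct.includeRight (R := S) (A := Q.ResidueField) (B := D)).restrictScalars R)
      fun _ _ => .all _ _
  have hcomp : hD.comp (Algebra.TensorProduct.map (AlgHom.id R p.ResidueField)
      (IsScalarTower.toAlgHom R S D)) =
      (IsScalarTower.toAlgHom R Q.ResidueField (Q.Fiber D)).comp hS := by
    ext x
    simp [hD, hS, Algebra.TensorProduct.algebraMap_apply]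
  have hint : Algebra.IsIntegral Q.ResidueField (Q.Fiber D) := ⟨fun z => by
    induction z using TensorProduct.induction_on with
    | zero => exact isIntegral_zero
    | add a b ha hb => exact ha.add hb
    | tmul a x =>
      have h1 : IsIntegral Q.ResidueField (1 ⊗ₜ[S] x : Q.Fiber D) := by
        obtain ⟨f, hf, hfx⟩ := H x
        refine ⟨f.map hS.toRingHom, hf.map _, ?_⟩
        have hx : hD.toRingHom (1 ⊗ₜ x) = 1 ⊗ₜ[S] x := by simp [hD]
        rw [← hx, Polynomial.eval₂_map]
        have := congrArg hD.toRingHom hfx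
        rw [Polynomial.hom_eval₂, map_zero] at this
        rw [← this]
        exact congrArg (fun g => Polynomial.eval₂ g _ f)
          (congrArg AlgHom.toRingHom hcomp).symm
      have : (a ⊗ₜ[S] x : Q.Fiber D) = a • (1 ⊗ₜ[S] x) := by
        rw [TensorProduct.smul_tmul', smul_eq_mul, mul_one]
      exact this ▸ h1.smul a⟩
  have hfin : Module.Finite Q.ResidueField (Q.Fiber D) := Algebra.IsIntegral.finite
  let e := PrimeSpectrum.preimageEquivFiber S D ⟨Q, inferInstance⟩
  let q := e ⟨⟨P, inferInstance⟩, rfl⟩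
  have hq : q.asIdeal.comap Algebra.TensorProduct.includeRight.toRingHom = P :=
    congrArg (fun z => z.1.asIdeal) (e.symm_apply_apply ⟨⟨P, inferInstance⟩, rfl⟩)
  exact .of_quasiFiniteAt_residueField Q P q.asIdeal hq

/-- A polynomial relation over a Dedekind domain can be made primitive at a given prime. -/
theorem MvPolynomial.exists_primitive_of_ne_zero {R σ : Type*} [CommRing R] [IsDedekindDomain R]
    (p : Ideal R) [p.IsPrime] {f : MvPolynomial σ R} (hf : f ≠ 0) :
    ∃ (f' : MvPolynomial σ R) (c j : R), c ≠ 0 ∧ C j * f = C c * f' ∧ ∃ m, f'.coeff m ∉ p := by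
  let I : Ideal R := Ideal.span f.coeffs
  obtain ⟨m₀, hm₀⟩ := MvPolynomial.ne_zero_iff.mp hf
  have hmem : ∀ m, f.coeff m ∈ I := fun m => by
    by_cases h : f.coeff m = 0
    · rw [h]; exact zero_mem _
    · exact Ideal.subset_span (MvPolynomial.coeff_mem_coeffs m h)
  set c := f.coeff m₀
  -- `J` plays the role of `c I⁻¹`: its elements bring all coefficients of `f` into `(c)`. As `I J =
  -- (c)` is not inside `(c) p`, some `j ∈ J` leaves a coefficient of `j f / c` outside `p`.
  obtain ⟨J, hJ⟩ : I ∣ Ideal.span {c} :=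
    Ideal.dvd_iff_le.mpr ((Ideal.span_singleton_le_iff_mem _).mpr (hmem m₀))
  have hnot : ¬ I * J ≤ Ideal.span {c} * p := by
    intro h
    rw [← hJ] at h
    have := h (Ideal.mem_span_singleton_self c)
    rw [Ideal.mem_span_singleton_mul] at this
    obtain ⟨z, hz, hcz⟩ := this
    have : z = 1 := mul_left_cancel₀ hm₀ (by rw [hcz, mul_one])
    exact (Ideal.ne_top_iff_one p).mp Ideal.IsPrime.ne_top' (this ▸ hz)
  obtain ⟨j, hjJ, m₁, hj⟩ : ∃ j ∈ J, ∃ m, j * f.coeff m ∉ Ideal.span {c} * p := by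
    by_contra! hcon
    refine hnot (Ideal.mul_le.mpr fun a ha j hj => ?_)
    induction ha using Submodule.span_induction with
    | mem x hx =>
      obtain ⟨m, -, rfl⟩ := MvPolynomial.mem_coeffs_iff.mp hx
      rw [mul_comm (f.coeff m) j]
      exact hcon j hj m
    | zero => rw [zero_mul]; exact zero_mem _
    | add x y _ _ hx hy => rw [add_mul]; exact add_mem hx hy
    | smul a x _ hx => rw [smul_eq_mul, mul_assoc]; exact Ideal.mul_mem_left _ _ hx
  have hdvd : ∀ m, ∃ e, j * f.coeff m = c * e := fun m => by
    have : j * f.coeff m ∈ Ideal.span {c} := by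
      rw [hJ, mul_comm j]; exact Ideal.mul_mem_mul (hmem m) hjJ
    exact Ideal.mem_span_singleton.mp this
  obtain ⟨f', hf'⟩ : C c ∣ C j * f := by
    rw [MvPolynomial.C_dvd_iff_dvd_coeff]
    intro m
    rw [MvPolynomial.coeff_C_mul]
    exact hdvd m
  refine ⟨f', c, j, hm₀, hf', m₁, fun hm => hj ?_⟩
  have := congrArg (MvPolynomial.coeff m₁) hf'
  rw [MvPolynomial.coeff_C_mul, MvPolynomial.coeff_C_mul] at this
  rw [this]
  exact Ideal.mul_mem_mul (Ideal.mem_span_singleton_self c) hm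

open TensorProduct in
/-- Locally, a finite type domain over a Dedekind domain is finite over a polynomial ring. -/
theorem exists_injective_mvPolynomial_zariskisMainProperty {R D : Type*} [CommRing R]
    [IsDedekindDomain R] [CommRing D] [IsDomain D] [Algebra R D] [FaithfulSMul R D]
    [Algebra.FiniteType R D] (P : Ideal D) [P.IsPrime] :
    ∃ (d : ℕ) (φ : MvPolynomial (Fin d) R →ₐ[R] D), Function.Injective φ ∧
      ∃ r ∉ P, ∀ x, ∃ m : ℕ, φ.toRingHom.IsIntegralElem (r ^ m * x) := by
  let p := P.under R
  let κ := p.ResidueField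
  have hne : Nontrivial (p.Fiber D) :=
    ((PrimeSpectrum.preimageEquivFiber R D ⟨p, inferInstance⟩)
      ⟨⟨P, inferInstance⟩, rfl⟩).nontrivial
  obtain ⟨d, g, hginj, hgint⟩ := exists_integral_inj_algHom_of_fg κ (p.Fiber D)
  -- Up to units `u i` of `κ`, the Noether parameters of the fibre come from elements `t i` of `D`;
  -- `sc` absorbs these units into the variables.
  choose u hu t ht using fun i : Fin d => Ideal.Fiber.exists_smul_eq_one_tmul p (g (MvPolynomial.X i))
  have hu0 : ∀ i, algebraMap R κ (u i) ≠ 0 := fun i => by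
    rw [ne_eq, Ideal.algebraMap_residueField_eq_zero]; exact hu i
  let sc : MvPolynomial (Fin d) κ ≃ₐ[κ] MvPolynomial (Fin d) κ := .ofAlgHom
    (MvPolynomial.aeval fun i => algebraMap R κ (u i) • MvPolynomial.X i)
    (MvPolynomial.aeval fun i => (algebraMap R κ (u i))⁻¹ • MvPolynomial.X i)
    (MvPolynomial.algHom_ext fun i => by
      rw [AlgHom.comp_apply, MvPolynomial.aeval_X, map_smul, MvPolynomial.aeval_X, smul_smul,
        inv_mul_cancel₀ (hu0 i), one_smul, AlgHom.id_apply])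
    (MvPolynomial.algHom_ext fun i => by
      rw [AlgHom.comp_apply, MvPolynomial.aeval_X, map_smul, MvPolynomial.aeval_X, smul_smul,
        mul_inv_cancel₀ (hu0 i), one_smul, AlgHom.id_apply])
  let φ : MvPolynomial (Fin d) R →ₐ[R] D := MvPolynomial.aeval t
  let g' : MvPolynomial (Fin d) κ →ₐ[κ] p.Fiber D := g.comp sc.toAlgHom
  have hg'inj : Function.Injective g' := hginj.comp sc.injective
  have hg'X : ∀ i, g' (MvPolynomial.X i) = 1 ⊗ₜ t i := fun i => by
    have : sc (MvPolynomial.X i) = algebraMap R κ (u i) • MvPolynomial.X i :=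
      MvPolynomial.aeval_X _ i
    rw [← ht, ← algebraMap_smul κ (u i), ← map_smul, ← this]
    rfl
  have hg'φ : ∀ f, g' (MvPolynomial.map (algebraMap R κ) f) = 1 ⊗ₜ φ f := by
    have : (g'.restrictScalars R).comp (MvPolynomial.mapAlgHom (Algebra.ofId R κ)) =
        Algebra.TensorProduct.includeRight.comp φ := by
      ext i
      simp [φ, hg'X]
    exact fun f => congrArg (fun h => h f) this
  have hφ : Function.Injective φ := by
    rw [injective_iff_map_eq_zero]
    intro f hf
    by_contra hf0
    -- Made primitive at `p`, the relation survives reduction to `κ`, contradicting injectivity of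
    -- `g'`.
    obtain ⟨f', c, j, hc, hcf, m, hm⟩ := MvPolynomial.exists_primitive_of_ne_zero p hf0
    have h1 : φ f' = 0 := by
      have h2 := congrArg φ hcf
      rw [map_mul, map_mul, hf, mul_zero] at h2
      refine (mul_eq_zero.mp h2.symm).resolve_left ?_
      rw [← MvPolynomial.algebraMap_eq, AlgHom.commutes]
      exact (map_ne_zero_iff _ (FaithfulSMul.algebraMap_injective R D)).mpr hc
    have h2 := hg'φ f'
    rw [h1, tmul_zero, map_eq_zero_iff _ hg'inj] at h2
    have h3 := congrArg (MvPolynomial.coeff m) h2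
    rw [MvPolynomial.coeff_map, MvPolynomial.coeff_zero, Ideal.algebraMap_residueField_eq_zero] at h3
    exact hm h3
  refine ⟨d, φ, hφ, ?_⟩
  let _ : Algebra (MvPolynomial (Fin d) R) D := φ.toRingHom.toAlgebra
  have : IsScalarTower R (MvPolynomial (Fin d) R) D := .of_algebraMap_eq fun r =>
    (φ.commutes r).symm
  have : Algebra.FiniteType (MvPolynomial (Fin d) R) D := .of_restrictScalars_finiteType R _ _
  have : Algebra.QuasiFiniteAt (MvPolynomial (Fin d) R) P := by
    refine .of_isIntegral_fiber (R := R) P fun x => ?_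
    -- `ι` undoes the rescaling, so that `g` factors through the fibre of the polynomial ring and
    -- integrality over `g` gives integrality over that fibre.
    let ι : MvPolynomial (Fin d) κ →ₐ[κ] p.Fiber (MvPolynomial (Fin d) R) :=
      (MvPolynomial.aeval fun i => 1 ⊗ₜ MvPolynomial.X i).comp sc.symm.toAlgHom
    have hι : (Algebra.TensorProduct.map (AlgHom.id κ κ)
        (IsScalarTower.toAlgHom R (MvPolynomial (Fin d) R) D)).comp ι = g := by
      have : (Algebra.TensorProduct.map (AlgHom.id κ κ)
        (IsScalarTower.toAlgHom R (MvPolynomial (Fin d) R) D)).comp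
          (MvPolynomial.aeval fun i => 1 ⊗ₜ MvPolynomial.X i) = g' := by
        ext i
        rw [hg'X, AlgHom.comp_apply, MvPolynomial.aeval_X, Algebra.TensorProduct.map_tmul, map_one]
        exact congrArg _ (MvPolynomial.aeval_X t i)
      ext1 i
      rw [← AlgHom.comp_assoc, this]
      exact congrArg g (sc.apply_symm_apply _)
    exact RingHom.IsIntegralElem.of_comp (f := ι.toRingHom) (by
      have := hgint (1 ⊗ₜ x)
      rw [← hι] at this
      exact this)
  exact Algebra.zariskisMainProperty_iff'.mp ((Algebra.ZariskisMainProperty.of_finiteType P))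

/-! ### Finite integral closures over N-2 Dedekind domains -/

/-- A module over a ring is finite if it is so up to powers of elements generating the unit ideal. -/
theorem Module.Finite.of_forall_prime_exists_pow_smul_mem {A M : Type*} [CommRing A] [AddCommGroup M]
    [Module A M]
    (H : ∀ P : Ideal A, P.IsPrime → ∃ r ∉ P, ∃ N : Submodule A M, N.FG ∧
      ∀ c : M, ∃ m : ℕ, r ^ m • c ∈ N) : Module.Finite A M := by
  let s : Set A := {r | ∃ N : Submodule A M, N.FG ∧ ∀ c : M, ∃ m : ℕ, r ^ m • c ∈ N}
  have hs : Ideal.span s = ⊤ := by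
    by_contra hne
    obtain ⟨P, hP, hle⟩ := Ideal.exists_le_maximal _ hne
    obtain ⟨r, hrP, hr⟩ := H P hP.isPrime
    exact hrP (hle (Ideal.subset_span hr))
  obtain ⟨t, hts, ht⟩ := (Ideal.span_eq_top_iff_finite s).mp hs
  choose N hN hc using fun r : t => hts r.2
  refine ⟨?_⟩
  have : (⨆ r, N r) = ⊤ := by
    rw [eq_top_iff]
    intro c _
    refine Submodule.mem_of_span_eq_top_of_smul_pow_mem _ (t : Set A) ht c fun r => ?_
    obtain ⟨m, hm⟩ := hc r c
    exact ⟨m, (le_iSup N r) hm⟩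
  rw [← this]
  exact Submodule.fg_iSup _ hN

/-- If elements of `D` become integral over `S` after multiplication by a power of `r`, then so do
elements integral over `D`. -/
theorem IsIntegral.exists_pow_smul {S D L : Type*} [CommRing S] [CommRing D] [CommRing L] [Algebra S D]
    [Algebra D L] [Algebra S L] [IsScalarTower S D L] {r : D}
    (H : ∀ x : D, ∃ m : ℕ, IsIntegral S (r ^ m * x)) {c : L} (hc : IsIntegral D c) :
    ∃ m : ℕ, IsIntegral S (r ^ m • c) := by
  cases subsingleton_or_nontrivial L
  · exact ⟨0, by rw [Subsingleton.elim (r ^ 0 • c) 0]; exact isIntegral_zero⟩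
  have : Nontrivial D := (algebraMap D L).domain_nontrivial
  have hr : IsIntegral S r := by
    obtain ⟨m, hm⟩ := H r
    rw [← pow_succ] at hm
    exact (IsIntegral.pow_iff (by simp)).mp hm
  obtain ⟨f, hf, hfc⟩ := hc
  choose m hm using H
  -- `scaleRoots` multiplies the `i`-th coefficient by `(r ^ M) ^ (natDegree - i)`. Below the
  -- leading term at least one factor `r ^ M` appears, enough to make the coefficient integral over
  -- `S`; the leading coefficient stays `1`.
  let M := f.support.sup fun i => m (f.coeff i)
  refine ⟨M, ?_⟩
  have hcoeff : ∀ i, IsIntegral S ((f.scaleRoots (r ^ M)).coeff i) := by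
    intro i
    rw [Polynomial.coeff_scaleRoots]
    by_cases hi : f.coeff i = 0
    · rw [hi, zero_mul]; exact isIntegral_zero
    rcases lt_or_ge i f.natDegree with hlt | hge
    · obtain ⟨k, hk⟩ := Nat.exists_eq_add_of_le
        (Finset.le_sup (f := fun i => m (f.coeff i)) (Polynomial.mem_support_iff.mpr hi))
      obtain ⟨l, hl⟩ := Nat.exists_eq_add_of_lt hlt
      have h1 : f.coeff i * (r ^ M) ^ (f.natDegree - i) =
          (r ^ m (f.coeff i) * f.coeff i) * (r ^ k * (r ^ M) ^ l) := by
        rw [hl, show i + l + 1 - i = l + 1 by omega, pow_succ]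
        conv_lhs => rw [show r ^ M = r ^ (m (f.coeff i)) * r ^ k by rw [← pow_add, ← hk]]
        rw [show r ^ M = r ^ (m (f.coeff i)) * r ^ k by rw [← pow_add, ← hk]]
        ring
      rw [h1]
      exact (hm _).mul ((hr.pow k).mul ((hr.pow M).pow l))
    · rw [Nat.sub_eq_zero_of_le hge, pow_zero, mul_one]
      rcases hge.eq_or_lt with h | h
      · rw [← h, hf.coeff_natDegree]; exact isIntegral_one
      · rw [Polynomial.coeff_eq_zero_of_natDegree_lt h]; exact isIntegral_zero
  by_cases hdeg : f.natDegree = 0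
  · rw [hf.natDegree_eq_zero.mp hdeg] at hfc
    simp at hfc
  refine IsIntegral.of_aeval_monic_of_isIntegral_coeff
    (p := (f.scaleRoots (r ^ M)).map (algebraMap D L))
    ((Polynomial.monic_scaleRoots_iff _).mpr hf |>.map _) ?_ ?_ fun i => ?_
  · rwa [((Polynomial.monic_scaleRoots_iff _).mpr hf).natDegree_map,
      Polynomial.natDegree_scaleRoots]
  · rw [Polynomial.eval_map, Algebra.smul_def, Polynomial.scaleRoots_eval₂_eq_zero _ hfc]
    exact isIntegral_zero
  · rw [Polynomial.coeff_map]
    exact (hcoeff i).algebraMap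

/-- A finite type domain over an N-2 Dedekind domain has finite integral closure in finite
extensions of its fraction field. -/
theorem IsN2Domain.finite_integralClosure_of_finiteType {R D L : Type u} [CommRing R]
    [IsDedekindDomain R] (h : IsN2Domain R) [CommRing D] [IsDomain D] [Algebra R D]
    [FaithfulSMul R D] [Algebra.FiniteType R D] [Field L] [Algebra D L] [FaithfulSMul D L]
    [Algebra.IsAlgebraic D L] [Algebra.EssFiniteType D L] :
    Module.Finite D (integralClosure D L) := by
  refine .of_forall_prime_exists_pow_smul_mem fun P hP => ?_
  obtain ⟨d, φ, hφ, r, hrP, hr⟩ := exists_injective_mvPolynomial_zariskisMainProperty (R := R) P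
  refine ⟨r, hrP, ?_⟩
  let S := MvPolynomial (Fin d) R
  let _ : Algebra S D := φ.toRingHom.toAlgebra
  have : IsScalarTower R S D := .of_algebraMap_eq fun r => (φ.commutes r).symm
  have : Algebra.FiniteType S D := .of_restrictScalars_finiteType R _ _
  let _ : Algebra S L := ((algebraMap D L).comp φ.toRingHom).toAlgebra
  have : IsScalarTower S D L := .of_algebraMap_eq' rfl
  have hDL := FaithfulSMul.algebraMap_injective D L
  have : FaithfulSMul S L := (faithfulSMul_iff_algebraMap_injective _ _).mpr (hDL.comp hφ)
  have hr' : ∀ x : D, ∃ m : ℕ, IsIntegral S (r ^ m * x) := hr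
  have hr0 : r ≠ 0 := fun h0 => hrP (h0 ▸ zero_mem _)
  have hrint : IsIntegral S r := by
    obtain ⟨m, hm⟩ := hr' r
    rw [← pow_succ] at hm
    exact (IsIntegral.pow_iff (by simp)).mp hm
  have : Algebra.IsAlgebraic S D := ⟨fun x => by
    rw [← isAlgebraic_algebraMap_iff hDL]
    obtain ⟨m, hm⟩ := hr' x
    have h1 : algebraMap D L x = algebraMap D L (r ^ m * x) * (algebraMap D L r ^ m)⁻¹ := by
      have : algebraMap D L r ≠ 0 := (map_ne_zero_iff _ hDL).mpr hr0
      simp only [map_mul, map_pow]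
      field_simp
    rw [h1]
    exact (hm.algebraMap (B := L)).isAlgebraic.mul ((hrint.algebraMap (B := L)).isAlgebraic.pow m).inv⟩
  have : Algebra.IsAlgebraic S L := .trans S D L
  have : Algebra.EssFiniteType S L := .comp S D L
  obtain ⟨s, hs⟩ := ((h.mvPolynomial d).finite_integralClosure (L := L)).fg_top
  let ι : integralClosure S L →ₗ[S] integralClosure D L :=
    { toFun := fun c => ⟨c, IsIntegral.tower_top c.2⟩
      map_add' := fun _ _ => rfl
      map_smul' := fun a c => Subtype.ext (by simp [Algebra.smul_def]) }
  -- `N` contains every element of `L` integral over `S`, hence `r ^ m • c` for every `c` integral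
  -- over `D` and a suitable `m`.
  let N := Submodule.span D (ι '' s)
  have hN : ∀ c, ι c ∈ N := fun c => by
    have : Submodule.span S (s : Set (integralClosure S L)) ≤ (N.restrictScalars S).comap ι :=
      Submodule.span_le.mpr fun x hx => Submodule.subset_span ⟨x, hx, rfl⟩
    exact this (hs ▸ Submodule.mem_top)
  refine ⟨N, Submodule.fg_span (s.finite_toSet.image ι), fun c => ?_⟩
  obtain ⟨m, hm⟩ := IsIntegral.exists_pow_smul hr' c.2
  exact ⟨m, hN ⟨_, hm⟩⟩

/-- `A` need not be a domain or embed in `L`. Its image `D` in `L` is a domain, finite over `A`, and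
whatever is integral over `A` is integral over `D`. -/
theorem IsN2Domain.finite_integralClosure_field {R A L : Type u} [CommRing R] [IsDedekindDomain R]
    (h : IsN2Domain R) [CommRing A] [Algebra R A] [Algebra.FiniteType R A] [Field L] [Algebra A L]
    [Algebra R L] [IsScalarTower R A L] [FaithfulSMul R L]
    [Algebra.IsAlgebraic (⊥ : Subalgebra A L) L] [Algebra.EssFiniteType A L] :
    Module.Finite A (integralClosure A L) := by
  let D := (⊥ : Subalgebra A L)
  have : IsNoetherianRing A := Algebra.FiniteType.isNoetherianRing R A
  have hsurj : Function.Surjective (algebraMap A D) := by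
    rintro ⟨_, a, rfl⟩
    exact ⟨a, rfl⟩
  have : Module.Finite A D := .of_surjective (Algebra.linearMap A D) hsurj
  have : Algebra.FiniteType R D := .trans (S := A) inferInstance inferInstance
  have : FaithfulSMul R D := (faithfulSMul_iff_algebraMap_injective _ _).mpr <|
    Function.Injective.of_comp (f := algebraMap D L) <| by
      rw [← RingHom.coe_comp, ← IsScalarTower.algebraMap_eq]
      exact FaithfulSMul.algebraMap_injective R L
  have : Algebra.EssFiniteType D L := .of_comp A D L
  have : Module.Finite D (integralClosure D L) := h.finite_integralClosure_of_finiteType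
  have : Module.Finite A (integralClosure D L) := .trans D _
  let f : integralClosure A L →ₗ[A] integralClosure D L :=
    { toFun := fun c => ⟨c, IsIntegral.tower_top c.2⟩
      map_add' := fun _ _ => rfl
      map_smul' := fun _ _ => rfl }
  exact .of_injective f fun a b hab => Subtype.ext (Subtype.ext_iff.mp hab :)

/-- Finiteness of the integral closure of a finite type algebra over an N-2 Dedekind domain `R` in a
reduced algebra which is finite over it away from finitely many fibres. -/
theorem IsN2Domain.finite_integralClosure_of_isReduced {R A B : Type u} [CommRing R]
    [IsDedekindDomain R] (h : IsN2Domain R) [CommRing A] [Algebra R A] [Algebra.FiniteType R A]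
    [CommRing B] [IsReduced B] [IsNoetherianRing B] [Algebra A B] [Algebra R B] [IsScalarTower R A B]
    [Algebra.EssFiniteType A B] (hunit : ∀ r : R, r ≠ 0 → IsUnit (algebraMap R B r))
    (hint : ∀ b : B, ∃ r : R, r ≠ 0 ∧ IsIntegral A (r • b)) :
    Module.Finite A (integralClosure A B) := by
  have : IsNoetherianRing A := Algebra.FiniteType.isNoetherianRing R A
  have hfin : (minimalPrimes B).Finite := minimalPrimes.finite_of_isNoetherianRing B
  have : Finite (minimalPrimes B) := hfin.to_subtype
  have hprime (p : minimalPrimes B) : p.1.IsPrime := p.2.1.1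
  -- Nonzero elements of `R` are units in `B`, so `R` embeds in each residue field, and `hint` makes
  -- that field algebraic over the image of `A`.
  have key (p : minimalPrimes B) : Module.Finite A (integralClosure A p.1.ResidueField) := by
    let L := p.1.ResidueField
    have hR : ∀ r : R, r ≠ 0 → algebraMap R L r ≠ 0 := fun r hr => by
      rw [IsScalarTower.algebraMap_apply R B L]
      exact ((hunit r hr).map (algebraMap B L)).ne_zero
    have : FaithfulSMul R L := (faithfulSMul_iff_algebraMap_injective _ _).mpr <|
      (injective_iff_map_eq_zero _).mpr fun r hr => by_contra fun h0 => hR r h0 hr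
    have : Algebra.EssFiniteType A L := .comp A B L
    let D := (⊥ : Subalgebra A L)
    have hB : ∀ b : B, IsAlgebraic D (algebraMap B L b) := by
      intro b
      obtain ⟨r, hr, hb⟩ := hint b
      have h1 : algebraMap B L b = algebraMap B L (r • b) * (algebraMap R L r)⁻¹ := by
        rw [Algebra.smul_def, map_mul, ← IsScalarTower.algebraMap_apply]
        rw [mul_comm (algebraMap R L r), mul_inv_cancel_right₀ (hR r hr)]
      rw [h1]
      refine ((hb.algebraMap (B := L)).tower_top (A := D)).isAlgebraic.mul (IsAlgebraic.inv ?_)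
      rw [IsScalarTower.algebraMap_apply R D L]
      exact isAlgebraic_algebraMap _
    have : Algebra.IsAlgebraic D L := ⟨fun x => by
      obtain ⟨a, b, -, rfl⟩ := IsFractionRing.div_surjective (A := B ⧸ p.1) x
      obtain ⟨a, rfl⟩ := Ideal.Quotient.mk_surjective a
      obtain ⟨b, rfl⟩ := Ideal.Quotient.mk_surjective b
      rw [div_eq_mul_inv]
      exact (hB a).mul (hB b).inv⟩
    exact h.finite_integralClosure_field (R := R)
  let f : integralClosure A B →ₗ[A] Π p : minimalPrimes B, integralClosure A p.1.ResidueField :=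
    LinearMap.pi fun p =>
      ((IsScalarTower.toAlgHom A B p.1.ResidueField).mapIntegralClosure).toLinearMap
  refine .of_injective f ((injective_iff_map_eq_zero f).mpr fun c hc => Subtype.ext ?_)
  -- An element vanishing in all these residue fields lies in every minimal prime, hence is
  -- nilpotent.
  have h0 : c.1 ∈ nilradical B := by
    rw [nilradical, ← Ideal.sInf_minimalPrimes, Submodule.mem_sInf]
    intro p hp
    have := hprime ⟨p, hp⟩
    rw [← Ideal.algebraMap_residueField_eq_zero (I := p)]
    exact congrArg Subtype.val (congrFun hc ⟨p, hp⟩)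
  rwa [nilradical_eq_zero] at h0

/-! ### Normality of rings -/

/-- Three denominators are cleared: `m₁` writes `s` as a fraction, `m₂` makes `s` integral over `C`,
and `m₃` lifts this integrality from `Bf` to `B`, where `C` is integrally closed. -/
theorem IsIntegrallyClosedIn.isLocalization {C B Cf Bf : Type*} [CommRing C] [CommRing B]
    [CommRing Cf] [CommRing Bf] [Algebra C B] [Algebra C Cf] [Algebra C Bf] [Algebra B Bf]
    [Algebra Cf Bf] [IsScalarTower C B Bf] [IsScalarTower C Cf Bf] (M : Submonoid C)
    [IsLocalization M Cf] [IsLocalization (Algebra.algebraMapSubmonoid B M) Bf]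
    [IsIntegrallyClosedIn C B] : IsIntegrallyClosedIn Cf Bf := by
  obtain ⟨hinj, hsurj⟩ := isIntegrallyClosedIn_iff.mp ‹IsIntegrallyClosedIn C B›
  refine isIntegrallyClosedIn_iff.mpr ⟨(injective_iff_map_eq_zero _).mpr fun x hx => ?_,
    fun {s} hs => ?_⟩
  · obtain ⟨c, m, rfl⟩ := IsLocalization.exists_mk'_eq M x
    have h1 : algebraMap B Bf (algebraMap C B c) = 0 := by
      rw [← IsScalarTower.algebraMap_apply, IsScalarTower.algebraMap_apply C Cf Bf,
        ← IsLocalization.mk'_spec Cf c m, map_mul, hx, zero_mul]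
    obtain ⟨⟨_, m', hm', rfl⟩, h⟩ :=
      (IsLocalization.map_eq_zero_iff (Algebra.algebraMapSubmonoid B M) Bf _).mp h1
    rw [IsLocalization.mk'_eq_zero_iff]
    exact ⟨⟨m', hm'⟩, hinj (by rw [map_mul, map_zero]; exact h)⟩
  · obtain ⟨⟨x, _, m₁, hm₁, rfl⟩, e⟩ := IsLocalization.surj (Algebra.algebraMapSubmonoid B M) s
    simp only [← IsScalarTower.algebraMap_apply] at e
    obtain ⟨⟨m₂, hm₂⟩, hm₂s⟩ := IsIntegral.exists_multiple_integral_of_isLocalization M _ hs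
    simp only [Submonoid.smul_def, Algebra.smul_def] at hm₂s
    obtain ⟨m₃, hm₃, hm₃s⟩ := IsLocalization.exists_isIntegral_smul_of_isIntegral_map (Sₘ := Bf)
      M (x := m₂ • x) <| by
        simp only [Algebra.smul_def, map_mul, ← IsScalarTower.algebraMap_apply, ← e, ← mul_assoc]
        exact hm₂s.mul (.algebraMap (Algebra.IsIntegral.isIntegral _))
    obtain ⟨y, hy⟩ := hsurj hm₃s
    refine ⟨IsLocalization.mk' Cf y (⟨m₁, hm₁⟩ * (⟨m₂, hm₂⟩ * ⟨m₃, hm₃⟩) : M), ?_⟩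
    have hu : IsUnit (algebraMap C Bf (m₁ * (m₂ * m₃))) := by
      rw [IsScalarTower.algebraMap_apply C Cf Bf]
      exact (IsLocalization.map_units Cf
        (⟨m₁, hm₁⟩ * (⟨m₂, hm₂⟩ * ⟨m₃, hm₃⟩) : M)).map (algebraMap Cf Bf)
    refine hu.mul_right_cancel ?_
    conv_lhs => rw [IsScalarTower.algebraMap_apply C Cf Bf (m₁ * (m₂ * m₃)), ← map_mul]
    have h1 := IsLocalization.mk'_spec Cf y (⟨m₁, hm₁⟩ * (⟨m₂, hm₂⟩ * ⟨m₃, hm₃⟩) : M)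
    simp only [Submonoid.coe_mul] at h1
    rw [h1, ← IsScalarTower.algebraMap_apply, IsScalarTower.algebraMap_apply C B Bf, hy]
    simp only [Algebra.smul_def, map_mul, ← IsScalarTower.algebraMap_apply, ← e]
    ring

/-- All localizations at primes are integrally closed domains. -/
def IsLocallyIntegrallyClosed (B : Type*) [CommRing B] : Prop :=
  ∀ (P : Ideal B) [P.IsPrime], IsDomain (Localization.AtPrime P) ∧
    IsIntegrallyClosed (Localization.AtPrime P)

namespace IsLocallyIntegrallyClosed

theorem isReduced {B : Type*} [CommRing B] (h : IsLocallyIntegrallyClosed B) : IsReduced B :=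
  isReduced_ofLocalizationMaximal B fun P _ => by
    have := (h P).1
    infer_instance

theorem localization {B : Type*} [CommRing B] (h : IsLocallyIntegrallyClosed B) (M : Submonoid B)
    (B' : Type*) [CommRing B'] [Algebra B B'] [IsLocalization M B'] :
    IsLocallyIntegrallyClosed B' := by
  intro P _
  have := IsLocalization.isLocalization_isLocalization_atPrime_isLocalization M
    (Localization.AtPrime P) P
  let e := IsLocalization.algEquiv (P.comap (algebraMap B B')).primeCompl
    (Localization.AtPrime (P.comap (algebraMap B B'))) (Localization.AtPrime P)
  obtain ⟨h1, h2⟩ := h (P.comap (algebraMap B B'))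
  exact ⟨e.symm.toRingEquiv.toMulEquiv.isDomain _, .of_equiv e.toRingEquiv⟩

theorem of_isArtinianRing {B : Type*} [CommRing B] [IsArtinianRing B] [IsReduced B] :
    IsLocallyIntegrallyClosed B := by
  intro P _
  have hF : IsField (Localization.AtPrime P) :=
    IsArtinianRing.isField_of_isReduced_of_isLocalRing _
  have := hF.isDomain
  exact ⟨this, hF.toField.instIsIntegrallyClosed⟩

/-- A locally integrally closed Noetherian ring without nontrivial idempotents is an integrally
closed domain. -/
theorem isDomain_and_isIntegrallyClosed {B : Type*} [CommRing B] [Nontrivial B] [IsNoetherianRing B]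
    (h : IsLocallyIntegrallyClosed B) (hB : ∀ e : B, e * e = e → e = 0 ∨ e = 1) :
    IsDomain B ∧ IsIntegrallyClosed B := by
  have hred := h.isReduced
  -- Since `B_m` is a domain, a prime `m` contains only one minimal prime. Distinct minimal primes
  -- are therefore comaximal, and `p` together with the intersection `I` of the others yields an
  -- idempotent.
  have hker : ∀ (m : Ideal B) [m.IsPrime], ∀ p ∈ minimalPrimes B, p ≤ m →
      p = RingHom.ker (algebraMap B (Localization.AtPrime m)) := by
    intro m _ p hp hpm
    have := (h m).1
    have hp' : p.IsPrime := hp.1.1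
    have hle : RingHom.ker (algebraMap B (Localization.AtPrime m)) ≤ p := fun x hx => by
      obtain ⟨s, hs⟩ := (IsLocalization.map_eq_zero_iff m.primeCompl _ x).mp hx
      exact (hp'.mem_or_mem (hs ▸ zero_mem p : s.1 * x ∈ p)).resolve_left fun h => s.2 (hpm h)
    exact le_antisymm (hp.2 ⟨RingHom.ker_isPrime _, bot_le⟩ hle) hle
  have hfin : (minimalPrimes B).Finite := minimalPrimes.finite_of_isNoetherianRing B
  obtain ⟨p, hp⟩ : Nonempty (minimalPrimes B) := Ideal.nonempty_minimalPrimes bot_ne_top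
  have hp' : p.IsPrime := hp.1.1
  classical
  let I : Ideal B := ⨅ q ∈ hfin.toFinset.erase p, q
  have hI : IsCoprime p I := by
    refine Ideal.isCoprime_biInf fun q hq => ?_
    rw [Finset.mem_erase, Set.Finite.mem_toFinset] at hq
    rw [Ideal.isCoprime_iff_sup_eq]
    by_contra hne
    obtain ⟨m, hm, hle⟩ := Ideal.exists_le_maximal _ hne
    have := hm.isPrime
    exact hq.1 ((hker m q hq.2 (le_sup_right.trans hle)).trans
      (hker m p hp (le_sup_left.trans hle)).symm)
  have hinf : p ⊓ I = ⊥ := by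
    rw [eq_bot_iff, ← Submodule.zero_eq_bot, ← nilradical_eq_zero B, nilradical,
      ← Ideal.sInf_minimalPrimes, le_sInf_iff]
    intro q hq
    by_cases hqp : q = p
    · exact hqp ▸ inf_le_left
    · exact inf_le_right.trans (iInf₂_le q
        (Finset.mem_erase.mpr ⟨hqp, hfin.mem_toFinset.mpr hq⟩))
  obtain ⟨e, he, e', he', hee⟩ := Submodule.mem_sup.mp
    ((Ideal.eq_top_iff_one _).mp (Ideal.isCoprime_iff_sup_eq.mp hI))
  have hmul : e * e' = 0 := by
    rw [← Ideal.mem_bot, ← hinf]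
    exact ⟨Ideal.mul_mem_right _ _ he, Ideal.mul_mem_left _ _ he'⟩
  have hbot : p = ⊥ := by
    rcases hB e (by linear_combination e * hee - hmul) with h0 | h1
    · rw [h0, zero_add] at hee
      rw [← hinf, (Ideal.eq_top_iff_one I).mpr (hee ▸ he'), inf_top_eq]
    · exact absurd (h1 ▸ he) ((Ideal.ne_top_iff_one p).mp hp'.ne_top)
  have hdom : IsDomain B := by
    rw [hbot] at hp'
    exact .of_bot_isPrime B
  exact ⟨hdom, .of_localization_maximal fun m _ _ => (h m).2⟩

/-- A locally integrally closed Noetherian ring is locally integrally closed after passing to an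
integrally closed subring. -/
theorem of_isIntegrallyClosedIn {C B : Type*} [CommRing C] [CommRing B] [IsNoetherianRing B]
    [Algebra C B] [IsIntegrallyClosedIn C B] (h : IsLocallyIntegrallyClosed B) :
    IsLocallyIntegrallyClosed C := by
  intro Q _
  let M := Algebra.algebraMapSubmonoid B Q.primeCompl
  let CQ := Localization.AtPrime Q
  let BQ := Localization M
  let _ : Algebra CQ BQ := localizationAlgebra Q.primeCompl B
  have : IsScalarTower C CQ BQ := .of_algebraMap_eq fun x =>
    (IsScalarTower.algebraMap_apply C B BQ x).trans
      (IsLocalization.map_eq (M := Q.primeCompl) (T := M) Q.primeCompl.le_comap_map x).symm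
  have hclosed : IsIntegrallyClosedIn CQ BQ := .isLocalization (C := C) (B := B) Q.primeCompl
  obtain ⟨hinj, hsurj⟩ := isIntegrallyClosedIn_iff.mp hclosed
  have : Nontrivial BQ := hinj.nontrivial
  have : IsNoetherianRing BQ := IsLocalization.isNoetherianRing M BQ inferInstance
  have hBQ : IsLocallyIntegrallyClosed BQ := h.localization M BQ
  -- Idempotents of `BQ` are roots of `X ^ 2 - X`, so they come from the local ring `CQ`, which has
  -- only trivial ones.
  obtain ⟨h1, h2⟩ := hBQ.isDomain_and_isIntegrallyClosed fun e he => by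
    have hint : IsIntegral CQ e := ⟨Polynomial.X ^ 2 - Polynomial.X,
      Polynomial.monic_X_pow_sub (by simp), by simp [sq, he]⟩
    obtain ⟨y, rfl⟩ := hsurj hint
    have hy : y * (1 - y) = 0 := by
      rw [← map_mul] at he
      rw [mul_sub, mul_one, hinj he, sub_self]
    rcases IsLocalRing.isUnit_or_isUnit_one_sub_self y with hu | hu
    · right
      rw [hu.mul_right_eq_zero, sub_eq_zero] at hy
      rw [← hy, map_one]
    · left
      rw [hu.mul_left_eq_zero] at hy
      rw [hy, map_zero]
  have : FaithfulSMul CQ BQ := (faithfulSMul_iff_algebraMap_injective _ _).mpr hinj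
  have : IsDomain CQ := hinj.isDomain _
  exact ⟨this, .of_isIntegrallyClosed_of_isIntegrallyClosedIn CQ BQ⟩

theorem of_isIntegrallyClosedIn_of_isArtinianRing {C T : Type*} [CommRing C] [CommRing T]
    [Algebra C T] [IsArtinianRing T] [IsReduced T] [IsIntegrallyClosedIn C T] :
    IsLocallyIntegrallyClosed C :=
  (of_isArtinianRing (B := T)).of_isIntegrallyClosedIn

theorem of_forall_exists_away {B : Type*} [CommRing B]
    (h : ∀ P : Ideal B, P.IsPrime → ∃ f ∉ P, IsLocallyIntegrallyClosed (Localization.Away f)) :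
    IsLocallyIntegrallyClosed B := by
  intro P hP
  obtain ⟨f, hf, hB⟩ := h P hP
  have hdisj : Disjoint (Submonoid.powers f : Set B) P := by
    rw [Ideal.disjoint_powers_iff_notMem _ hP.isRadical]; exact hf
  let P' := P.map (algebraMap B (Localization.Away f))
  have hP' : P'.IsPrime := IsLocalization.isPrime_of_isPrime_disjoint (.powers f) _ P hP hdisj
  have hcomap : P'.comap (algebraMap B (Localization.Away f)) = P :=
    IsLocalization.under_map_of_isPrime_disjoint (.powers f) _ hP hdisj
  have hloc : IsLocalization.AtPrime (Localization.AtPrime P')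
      (P'.comap (algebraMap B (Localization.Away f))) :=
    IsLocalization.isLocalization_isLocalization_atPrime_isLocalization (.powers f) _ P'
  simp only [hcomap] at hloc
  let e := IsLocalization.algEquiv P.primeCompl (Localization.AtPrime P') (Localization.AtPrime P)
  obtain ⟨h1, h2⟩ := hB P'
  exact ⟨e.symm.toRingEquiv.toMulEquiv.isDomain _, .of_equiv e.toRingEquiv⟩

open TensorProduct in
/-- An étale algebra over an integrally closed domain is locally integrally closed. -/
theorem of_etale {S B : Type*} (E : Type*) [CommRing S] [IsDomain S] [IsIntegrallyClosed S] [Field E]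
    [Algebra S E] [IsFractionRing S E] [CommRing B] [Algebra S B] [Algebra.Etale S B] :
    IsLocallyIntegrallyClosed B := by
  have : Algebra.Etale E (E ⊗[S] B) := inferInstance
  have : Module.Finite E (E ⊗[S] B) := Algebra.FormallyUnramified.finite_of_free E _
  have : IsArtinianRing (E ⊗[S] B) := .of_finite E _
  have : IsReduced (E ⊗[S] B) := Algebra.FormallyUnramified.isReduced_of_field E _
  let e := Algebra.TensorProduct.comm S B E
  have : IsArtinianRing (B ⊗[S] E) :=
    Function.Surjective.isArtinianRing (f := e.symm.toRingHom) e.symm.surjective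
  have : IsReduced (B ⊗[S] E) := isReduced_of_injective e.toRingHom e.injective
  -- Smooth base change identifies the integral closure of `B` in `B ⊗ E` with `B ⊗` the integral
  -- closure of `S` in `E`, which is `S` itself.
  have : IsIntegrallyClosedIn B (B ⊗[S] E) := by
    refine isIntegrallyClosedIn_iff.mpr
      ⟨Algebra.TensorProduct.includeLeft_injective (S := S) (IsFractionRing.injective S E),
        fun {x} hx => ?_⟩
    obtain ⟨z, hz⟩ := (TensorProduct.toIntegralClosure_bijective_of_smooth
      (R := S) (S := B) (B := E)).2 ⟨x, hx⟩
    obtain rfl : _ = x := congrArg Subtype.val hz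
    rw [← RingHom.mem_range]
    clear hz hx
    induction z using TensorProduct.induction_on with
    | zero => rw [map_zero]; exact zero_mem _
    | add a b ha hb => rw [map_add]; exact add_mem ha hb
    | tmul b c =>
      obtain ⟨s, hs⟩ := IsIntegrallyClosed.isIntegral_iff.mp c.2
      refine ⟨s • b, ?_⟩
      change (s • b) ⊗ₜ[S] (1 : E) = b ⊗ₜ[S] c.1
      rw [← hs, smul_tmul, Algebra.smul_def, mul_one]
  exact of_isIntegrallyClosedIn_of_isArtinianRing (T := B ⊗[S] E)

/-- A smooth algebra over a field is locally integrally closed. -/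
theorem of_smooth (K : Type*) {B : Type*} [Field K] [CommRing B] [Algebra K B] [Algebra.Smooth K B] :
    IsLocallyIntegrallyClosed B := by
  refine of_forall_exists_away fun P hP => ?_
  -- Locally a smooth algebra is étale over a polynomial ring, which is integrally closed.
  obtain ⟨f, hfP, n, _, _, _⟩ :=
    Algebra.IsSmoothAt.exists_isStandardEtale_mvPolynomial (R := K) (p := P)
  exact ⟨f, hfP, of_etale (S := MvPolynomial (Fin n) K) (FractionRing (MvPolynomial (Fin n) K))⟩

end IsLocallyIntegrallyClosed

/-! ### Normal and Dedekind schemes, and generic fibres -/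

theorem AlgebraicGeometry.IsAffineOpen.isLocallyIntegrallyClosed {X : Scheme.{u}}
    (hX : IsNormalScheme X) {U : X.Opens} (hU : IsAffineOpen U) :
    IsLocallyIntegrallyClosed Γ(X, U) := by
  intro P hP
  have hmem : hU.fromSpec ⟨P, hP⟩ ∈ U := by
    rw [← SetLike.mem_coe, ← hU.range_fromSpec]
    exact ⟨_, rfl⟩
  let _ := TopCat.Presheaf.algebra_section_stalk X.presheaf ⟨hU.fromSpec ⟨P, hP⟩, hmem⟩
  have hloc : IsLocalization.AtPrime (X.presheaf.stalk (hU.fromSpec ⟨P, hP⟩)) P :=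
    hU.isLocalization_stalk' ⟨P, hP⟩ hmem
  let e := (IsLocalization.algEquiv P.primeCompl (Localization.AtPrime P)
    (X.presheaf.stalk (hU.fromSpec ⟨P, hP⟩))).toRingEquiv
  obtain ⟨_, _⟩ := hX (hU.fromSpec ⟨P, hP⟩)
  exact ⟨e.toMulEquiv.isDomain _, .of_equiv e.symm⟩

theorem IsNormalScheme.of_forall_exists_isAffineOpen {X : Scheme.{u}}
    (h : ∀ x : X, ∃ U : X.Opens, IsAffineOpen U ∧ x ∈ U ∧ IsLocallyIntegrallyClosed Γ(X, U)) :
    IsNormalScheme X := by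
  intro x
  obtain ⟨U, hU, hx, hn⟩ := h x
  let _ := TopCat.Presheaf.algebra_section_stalk X.presheaf ⟨x, hx⟩
  have hloc := hU.isLocalization_stalk ⟨x, hx⟩
  let P := (hU.primeIdealOf ⟨x, hx⟩).asIdeal
  let e := (IsLocalization.algEquiv P.primeCompl (Localization.AtPrime P)
    (X.presheaf.stalk x)).toRingEquiv
  obtain ⟨_, _⟩ := hn P
  exact ⟨e.symm.toMulEquiv.isDomain _, .of_equiv e⟩

instance IsDedekindScheme.isIntegral (S : Scheme.{u}) [IsDedekindScheme S] : IsIntegral S := by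
  have (x : S) : _root_.IsReduced (S.presheaf.stalk x) := by
    have := (IsDedekindScheme.normal (S := S) x).1
    infer_instance
  have : IsReduced S := isReduced_of_isReduced_stalk S
  exact isIntegral_of_irreducibleSpace_of_isReduced S

/-- `IsDedekindDomain` allows fields, so it suffices that `W` has dimension at most one, which an
open subscheme inherits. -/
theorem IsDedekindScheme.isDedekindDomain {S : Scheme.{u}} [IsDedekindScheme S] {W : S.Opens}
    (hW : IsAffineOpen W) [Nonempty W] : IsDedekindDomain Γ(S, W) := by
  have hn : IsNoetherianRing Γ(S, W) := IsLocallyNoetherian.component_noetherian ⟨W, hW⟩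
  have hic : IsIntegrallyClosed Γ(S, W) := .of_localization_maximal fun P _ _ ↦
    (hW.isLocallyIntegrallyClosed IsDedekindScheme.normal P).2
  have hdim : Ring.KrullDimLE 1 Γ(S, W) := by
    rw [Ring.krullDimLE_iff, ← PrimeSpectrum.topologicalKrullDim_eq_ringKrullDim]
    have := hW.fromSpec.isOpenEmbedding.isInducing.topologicalKrullDim_le
    rwa [IsDedekindScheme.dim_eq_one (S := S)] at this
  have hdim' : Ring.DimensionLEOne Γ(S, W) :=
    ⟨fun hp hP ↦ Ring.krullDimLE_one_iff_of_noZeroDivisors.mp hdim _ hp hP⟩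
  exact { }

theorem IsN2Domain.of_ringEquiv {R R' : Type u} [CommRing R] [IsDomain R] [CommRing R']
    [IsDomain R'] (e : R ≃+* R') (h : IsN2Domain R') : IsN2Domain R := by
  intro L _ _ _ _ _
  have : FaithfulSMul R L := .trans R (FractionRing R) L
  have : Algebra.IsAlgebraic R L := (IsFractionRing.comap_isAlgebraic_iff (K := FractionRing R)).mpr
    inferInstance
  let _ : Algebra R R' := e.toRingHom.toAlgebra
  let _ : Algebra R' L := ((algebraMap R L).comp e.symm.toRingHom).toAlgebra
  have : IsScalarTower R R' L := .of_algebraMap_eq fun r ↦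
    congrArg (algebraMap R L) (e.symm_apply_apply r).symm
  have : FaithfulSMul R' L := (faithfulSMul_iff_algebraMap_injective _ _).mpr
    ((FaithfulSMul.algebraMap_injective R L).comp e.symm.injective)
  have : Algebra.IsAlgebraic R' L := .extendScalars (R := R) e.injective
  have : Algebra.EssFiniteType R L := .comp R (FractionRing R) L
  have : Algebra.EssFiniteType R' L := .of_comp R R' L
  have hfin : Module.Finite R' (integralClosure R' L) := h.finite_integralClosure
  have : Module.Finite R R' := .of_surjective (Algebra.linearMap R R') e.surjective
  have : Module.Finite R (integralClosure R' L) := .trans R' _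
  let f : integralClosure R' L →ₗ[R] integralClosure R L :=
    { toFun c := ⟨c, (isIntegral_trans (R := R) (c : L) c.2 :)⟩
      map_add' _ _ := rfl
      map_smul' _ _ := rfl }
  exact .of_surjective f fun c ↦ ⟨⟨c, c.2.tower_top⟩, rfl⟩

theorem IsNagataRing.isN2Domain {R : Type u} [CommRing R] [IsDomain R] (h : IsNagataRing R) :
    IsN2Domain R :=
  have := Ideal.isPrime_bot (α := R)
  .of_ringEquiv (RingEquiv.quotientBot R).symm (h.2 ⊥)

theorem genericPointHom_preimage {S : Scheme.{u}} [IsIntegral S] (W : S.Opens) [h : Nonempty W] :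
    genericPointHom S ⁻¹ᵁ W = ⊤ := by
  ext x
  have hx : genericPointHom S x ⤳ genericPoint S := by
    have : genericPointHom S x ∈ Set.range (genericPointHom S) := ⟨x, rfl⟩
    rwa [Scheme.range_fromSpecStalk] at this
  have : genericPoint S ∈ W :=
    ((genericPoint_spec S).mem_open_set_iff W.isOpen).mpr (by simpa using h)
  simpa using hx.mem_open W.isOpen this

instance {S : Scheme.{u}} [IsIntegral S] : IsAffineHom (genericPointHom S) where
  isAffine_preimage W hW := by
    by_cases h : Nonempty W
    · rw [genericPointHom_preimage]
      exact isAffineOpen_top _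
    · have : W = ⊥ := by
        ext x
        simpa using fun hx ↦ h ⟨x, hx⟩
      subst this
      exact isAffineOpen_bot _

theorem isFractionRing_genericPointHom {S : Scheme.{u}} [IsIntegral S] {W : S.Opens}
    (hW : IsAffineOpen W) [Nonempty W] :
    @IsFractionRing Γ(S, W) _ Γ(Spec S.functionField, ⊤) _
      ((genericPointHom S).appLE W ⊤ (genericPointHom_preimage W).ge).hom.toAlgebra := by
  have := functionField_isFractionRing_of_isAffineOpen S W hW
  have happ : (genericPointHom S).appLE W ⊤ (genericPointHom_preimage W).ge =
      S.germToFunctionField W ≫ (Scheme.ΓSpecIso S.functionField).inv := by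
    rw [Scheme.Hom.appLE, Scheme.fromSpecStalk_app
      (((genericPoint_spec S).mem_open_set_iff W.isOpen).mpr (by simpa using ‹Nonempty W›)),
      Category.assoc, Category.assoc, ← Functor.map_comp]
    exact congr(_ ≫ _ ≫ $((Spec S.functionField).presheaf.map_id _)).trans (by simp)
  let _ := ((genericPointHom S).appLE W ⊤ (genericPointHom_preimage W).ge).hom.toAlgebra
  let e : S.functionField ≃ₐ[Γ(S, W)] Γ(Spec S.functionField, ⊤) :=
    { (Scheme.ΓSpecIso S.functionField).symm.commRingCatIsoToRingEquiv with
      commutes' r := by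
        change _ = ((genericPointHom S).appLE W ⊤ (genericPointHom_preimage W).ge).hom r
        rw [happ]
        rfl }
  exact IsLocalization.isLocalization_of_algEquiv _ e

theorem isFractionRing_genericPointHom_app {S : Scheme.{u}} [IsIntegral S] {W : S.Opens}
    (hW : IsAffineOpen W) [Nonempty W] :
    @IsFractionRing Γ(S, W) _ Γ(Spec S.functionField, genericPointHom S ⁻¹ᵁ W) _
      ((genericPointHom S).app W).hom.toAlgebra := by
  have key (V : (Spec S.functionField).Opens) (hV : V = ⊤) (e : V ≤ genericPointHom S ⁻¹ᵁ W) :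
      @IsFractionRing Γ(S, W) _ Γ(Spec S.functionField, V) _
        ((genericPointHom S).appLE W V e).hom.toAlgebra := by
    subst hV
    exact isFractionRing_genericPointHom hW
  rw [Scheme.Hom.app_eq_appLE]
  exact key _ (genericPointHom_preimage W) le_rfl

/-- Sections of the generic fibre over an affine open are a localization. -/
theorem isLocalization_app_of_isPullback_genericPointHom {S Z ZK : Scheme.{u}}
    [AlgebraicGeometry.IsIntegral S] {p : Z ⟶ S} {j : ZK ⟶ Z} {a : ZK ⟶ Spec S.functionField}
    (H : IsPullback j a p (genericPointHom S)) {W : S.Opens} {U : Z.Opens} (hW : IsAffineOpen W)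
    [Nonempty W] (hU : IsAffineOpen U) (e : U ≤ p ⁻¹ᵁ W) :
    @IsLocalization Γ(Z, U) _ ((nonZeroDivisors Γ(S, W)).map (p.appLE W U e).hom)
      Γ(ZK, j ⁻¹ᵁ U) _ (j.app U).hom.toAlgebra := by
  -- On affine opens the cartesian square becomes a pushout of rings: the sections of the generic
  -- fibre are `Γ(Z, U) ⊗ K`, a localization since `K` is one of `Γ(S, W)`.
  have hpush := (isIso_pushoutSection_iff H (UY := j ⁻¹ᵁ U) (genericPointHom_preimage W).ge e
    (by simp)).mp (isIso_pushoutSection_of_isAffineOpen H _ _ _ hW (isAffineOpen_top _) hU)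
  let _ := ((genericPointHom S).appLE W ⊤ (genericPointHom_preimage W).ge).hom.toAlgebra
  let _ := (p.appLE W U e).hom.toAlgebra
  let _ := (j.app U).hom.toAlgebra
  let _ := (a.appLE ⊤ (j ⁻¹ᵁ U) (by simp)).hom.toAlgebra
  let _ := ((j.app U).hom.comp (p.appLE W U e).hom).toAlgebra
  have : IsScalarTower Γ(S, W) Γ(Z, U) Γ(ZK, j ⁻¹ᵁ U) := .of_algebraMap_eq' rfl
  have hw := hpush.w
  rw [← Scheme.Hom.app_eq_appLE] at hw hpush
  have : IsScalarTower Γ(S, W) Γ(Spec S.functionField, ⊤) Γ(ZK, j ⁻¹ᵁ U) :=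
    .of_algebraMap_eq' congr(($hw).hom)
  have := isFractionRing_genericPointHom hW
  have h : Algebra.IsPushout Γ(S, W) Γ(Z, U) Γ(Spec S.functionField, ⊤) Γ(ZK, j ⁻¹ᵁ U) :=
    CommRingCat.isPushout_iff_isPushout.mp hpush
  exact (Algebra.isLocalization_iff_isPushout (nonZeroDivisors Γ(S, W))
    Γ(Spec S.functionField, ⊤)).mpr h

/-! ### Relative normalization -/

theorem AlgebraicGeometry.Scheme.Hom.isIntegralClosure_normalization {X Y : Scheme.{u}} (f : X ⟶ Y)
    [QuasiCompact f] [QuasiSeparated f] {U : Y.Opens} (hU : IsAffineOpen U) :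
    let _ := (f.app U).hom.toAlgebra
    let _ := (f.toNormalization.appLE (f.fromNormalization ⁻¹ᵁ U) (f ⁻¹ᵁ U)
      (by simp [← Scheme.Hom.comp_preimage])).hom.toAlgebra
    IsIntegralClosure Γ(f.normalization, f.fromNormalization ⁻¹ᵁ U) Γ(Y, U) Γ(X, f ⁻¹ᵁ U) := by
  intro _ alg
  have hval := f.normalizationObjIso_hom_val hU
  have hmap (c : Γ(f.normalization, f.fromNormalization ⁻¹ᵁ U)) :
      algebraMap _ Γ(X, f ⁻¹ᵁ U) c = ((f.normalizationObjIso hU).hom c).1 :=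
    congr(($hval.symm).hom c)
  refine ⟨fun x y hxy ↦ ?_, fun {x} ↦ ⟨fun hx ↦ ?_, ?_⟩⟩
  · rw [hmap, hmap] at hxy
    exact (f.normalizationObjIso hU).commRingCatIsoToRingEquiv.injective (Subtype.ext hxy)
  · refine ⟨(f.normalizationObjIso hU).inv ⟨x, hx⟩, ?_⟩
    rw [hmap]
    exact congr(($((f.normalizationObjIso hU).inv_hom_id).hom ⟨x, hx⟩).1)
  · rintro ⟨c, rfl⟩
    rw [hmap]
    exact ((f.normalizationObjIso hU).hom c).2

theorem AlgebraicGeometry.Scheme.Hom.isScalarTower_normalization {X Y : Scheme.{u}} (f : X ⟶ Y)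
    [QuasiCompact f] [QuasiSeparated f] (U : Y.Opens) :
    let _ := (f.app U).hom.toAlgebra
    let _ := (f.fromNormalization.app U).hom.toAlgebra
    let _ := (f.toNormalization.appLE (f.fromNormalization ⁻¹ᵁ U) (f ⁻¹ᵁ U)
      (by simp [← Scheme.Hom.comp_preimage])).hom.toAlgebra
    IsScalarTower Γ(Y, U) Γ(f.normalization, f.fromNormalization ⁻¹ᵁ U) Γ(X, f ⁻¹ᵁ U) := by
  intro _ _ _
  refine .of_algebraMap_eq' ?_
  change (f.app U).hom = (f.fromNormalization.app U ≫ f.toNormalization.appLE _ _ _).hom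
  rw [Scheme.Hom.app_eq_appLE f.fromNormalization, Scheme.Hom.appLE_comp_appLE,
    Scheme.Hom.app_eq_appLE]
  simp

/-- Over an affine open this says that a Dedekind domain is integrally closed in its fraction field.
It is the input for the weak extension property. -/
theorem isIso_fromNormalization_genericPointHom {S : Scheme.{u}} [IsDedekindScheme S] :
    IsIso (genericPointHom S).fromNormalization := by
  refine IsZariskiLocalAtTarget.of_forall_exists_morphismRestrict (P := .isomorphisms _) fun x ↦ ?_
  obtain ⟨_, ⟨W, hW, rfl⟩, hx, -⟩ := S.isBasis_affineOpens.exists_subset_of_mem_open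
    (Set.mem_univ x) isOpen_univ
  refine ⟨W, hx, (isIso_morphismRestrict_iff_isIso_app _ hW).mpr ?_⟩
  have : Nonempty W := ⟨⟨x, hx⟩⟩
  have := IsDedekindScheme.isDedekindDomain hW
  let _ := ((genericPointHom S).app W).hom.toAlgebra
  let _ := ((genericPointHom S).toNormalization.appLE ((genericPointHom S).fromNormalization ⁻¹ᵁ W)
    (genericPointHom S ⁻¹ᵁ W) (by simp [← Scheme.Hom.comp_preimage])).hom.toAlgebra
  let _ := ((genericPointHom S).fromNormalization.app W).hom.toAlgebra
  have := isFractionRing_genericPointHom_app hW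
  have := (genericPointHom S).isIntegralClosure_normalization hW
  have := (genericPointHom S).isScalarTower_normalization W
  let e : Γ(S, W) ≃ₐ[Γ(S, W)]
      Γ((genericPointHom S).normalization, (genericPointHom S).fromNormalization ⁻¹ᵁ W) :=
    IsIntegralClosure.equiv Γ(S, W) _ Γ(Spec S.functionField, genericPointHom S ⁻¹ᵁ W) _
  refine (ConcreteCategory.isIso_iff_bijective _).mpr ?_
  convert e.bijective
  ext x
  exact (e.commutes x).symm

theorem IsIntegralClosure.isIntegrallyClosedIn (A C B : Type*) [CommRing A] [CommRing B]
    [CommRing C] [Algebra A B] [Algebra A C] [Algebra C B] [IsScalarTower A C B]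
    [IsIntegralClosure C A B] : IsIntegrallyClosedIn C B := by
  have : Algebra.IsIntegral A C := IsIntegralClosure.isIntegral_algebra A B
  refine isIntegrallyClosedIn_iff.mpr ⟨IsIntegralClosure.algebraMap_injective C A B, fun hx ↦ ?_⟩
  exact IsIntegralClosure.isIntegral_iff.mp (isIntegral_trans (R := A) _ hx)

/-- Elements of `B` are integral over `AK`, so a multiple by some `m ∈ M` is integral over `A` and
lies in `C`. Thus passing to the integral closure leaves the generic fibre equal to `B`. -/
theorem IsIntegralClosure.isLocalization_of_finite (A AK C B : Type*) [CommRing A] [CommRing AK]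
    [CommRing B] [CommRing C] [Algebra A AK] [Algebra AK B] [Algebra A B] [IsScalarTower A AK B]
    [Algebra A C] [Algebra C B] [IsScalarTower A C B] [IsIntegralClosure C A B] (M : Submonoid A)
    [IsLocalization M AK] [Module.Finite AK B] :
    IsLocalization (Algebra.algebraMapSubmonoid C M) B := by
  have hunit (m : M) : IsUnit (algebraMap A B m) := by
    rw [IsScalarTower.algebraMap_apply A AK B]
    exact (IsLocalization.map_units AK m).map _
  refine ⟨?_, fun b ↦ ?_, fun {x y} hxy ↦ ⟨1, ?_⟩⟩
  · rintro ⟨_, m, hm, rfl⟩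
    rw [← IsScalarTower.algebraMap_apply]
    exact hunit ⟨m, hm⟩
  · obtain ⟨m, hm⟩ := IsIntegral.exists_multiple_integral_of_isLocalization M (Rₘ := AK) b
      (.of_finite AK b)
    obtain ⟨c, hc⟩ := (IsIntegralClosure.isIntegral_iff (A := C)).mp hm
    refine ⟨⟨c, _, m, m.2, rfl⟩, ?_⟩
    rw [hc, ← IsScalarTower.algebraMap_apply, Submonoid.smul_def, Algebra.smul_def, mul_comm]
  · rw [IsIntegralClosure.algebraMap_injective C A B hxy]

/-- Properties of the integral closure `C` of a finite type algebra `A` over an N-2 Dedekind domain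
`R` in a normal algebra `B` which is finite over the generic fibre of `A`. -/
theorem IsIntegralClosure.properties_of_isN2Domain {R A AK B C : Type u} [CommRing R]
    [IsDedekindDomain R] (h : IsN2Domain R) [CommRing A] [CommRing AK] [CommRing B] [CommRing C]
    [Algebra R A] [Algebra.FiniteType R A] [Algebra A AK] [Algebra AK B] [Algebra A B]
    [IsScalarTower A AK B] [Algebra A C] [Algebra C B] [IsScalarTower A C B]
    [IsIntegralClosure C A B] [Algebra R C] [IsScalarTower R A C]
    [IsLocalization (Algebra.algebraMapSubmonoid A (nonZeroDivisors R)) AK] [Module.Finite AK B]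
    (hB : IsLocallyIntegrallyClosed B) :
    Module.Finite A C ∧ IsLocallyIntegrallyClosed C ∧ Module.Flat R C ∧
      IsLocalization (Algebra.algebraMapSubmonoid C (nonZeroDivisors R)) B := by
  let M := Algebra.algebraMapSubmonoid A (nonZeroDivisors R)
  have hM : Algebra.algebraMapSubmonoid C M = Algebra.algebraMapSubmonoid C (nonZeroDivisors R) := by
    ext c
    simp [M, Algebra.algebraMapSubmonoid, Submonoid.mem_map, IsScalarTower.algebraMap_apply R A C]
  have hloc : IsLocalization (Algebra.algebraMapSubmonoid C (nonZeroDivisors R)) B := by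
    rw [← hM]
    exact IsIntegralClosure.isLocalization_of_finite A AK C B M
  let _ : Algebra R B := ((algebraMap C B).comp (algebraMap R C)).toAlgebra
  have : IsScalarTower R C B := .of_algebraMap_eq' rfl
  have : IsScalarTower R A B := .of_algebraMap_eq' (by
    rw [IsScalarTower.algebraMap_eq A C B, RingHom.comp_assoc, ← IsScalarTower.algebraMap_eq R A C,
      IsScalarTower.algebraMap_eq R C B])
  have hunit (r : R) (hr : r ≠ 0) : IsUnit (algebraMap R B r) := by
    rw [IsScalarTower.algebraMap_apply R C B]
    exact IsLocalization.map_units B (⟨_, r, mem_nonZeroDivisors_of_ne_zero hr, rfl⟩ :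
        Algebra.algebraMapSubmonoid C (nonZeroDivisors R))
  have hint (b : B) : ∃ r : R, r ≠ 0 ∧ IsIntegral A (r • b) := by
    obtain ⟨⟨_, r, hr, rfl⟩, hm⟩ := IsIntegral.exists_multiple_integral_of_isLocalization
      M (Rₘ := AK) b (.of_finite AK b)
    exact ⟨r, nonZeroDivisors.ne_zero hr, by simpa [Submonoid.smul_def] using hm⟩
  have : IsNoetherianRing A := Algebra.FiniteType.isNoetherianRing R A
  have : IsNoetherianRing AK := IsLocalization.isNoetherianRing M AK inferInstance
  have : IsNoetherianRing B := .of_finite AK B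
  have := hB.isReduced
  have : Algebra.EssFiniteType A AK := .of_isLocalization _ M
  have : Algebra.EssFiniteType A B := .comp A AK B
  have := h.finite_integralClosure_of_isReduced hunit hint
  have := IsIntegralClosure.isIntegrallyClosedIn A C B
  -- Flatness over a Dedekind domain is torsion-freeness, inherited from `B`, where nonzero elements
  -- of `R` are units.
  have : Module.IsTorsionFree R C := by
    refine ⟨fun r hr x y hxy ↦ IsIntegralClosure.algebraMap_injective C A B ?_⟩
    refine (hunit r hr.ne_zero).mul_left_cancel ?_
    simpa [Algebra.smul_def, ← IsScalarTower.algebraMap_apply] using congrArg (algebraMap C B) hxy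
  exact ⟨.equiv (IsIntegralClosure.equiv A (integralClosure A B) B C).toLinearEquiv,
    .of_isIntegrallyClosedIn hB, inferInstance, hloc⟩

/-! ### The weak extension property -/

/-- The weak extension property passes along integral morphisms. -/
theorem WeakExtensionProperty.of_isIntegralHom {S X Y : Scheme.{u}} [IsDedekindScheme S] {p : X ⟶ S}
    {q : Y ⟶ S} (h : X ⟶ Y) [IsIntegralHom h] (hp : h ≫ q = p) (hq : WeakExtensionProperty q) :
    WeakExtensionProperty p := by
  subst hp
  intro Z z _ uK huK
  let m : pullback (h ≫ q) (genericPointHom S) ⟶ pullback q (genericPointHom S) :=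
    pullback.lift (pullback.fst _ _ ≫ h) (pullback.snd _ _) (by
      rw [Category.assoc, pullback.condition])
  have hm : m ≫ pullback.fst _ _ = pullback.fst _ _ ≫ h := pullback.lift_fst ..
  have hm' : m ≫ pullback.snd _ _ = pullback.snd _ _ := pullback.lift_snd ..
  obtain ⟨v, hv, hvK⟩ := hq Z z (uK ≫ m) (by rw [Category.assoc, hm', huK])
  let r := pullback.snd (genericPointHom S) z
  -- `Z` is its own normalization in `Z_K`, by smooth base change from `S`.
  have : IsIso r.fromNormalization := by
    have := isIso_fromNormalization_genericPointHom (S := S)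
    rw [← Scheme.Hom.normalizationPullback_snd]
    infer_instance
  have hr : (pullbackSymmetry z (genericPointHom S)).hom ≫ r = pullback.fst _ _ := by simp [r]
  -- `t` is a section over `Z_K` of the integral morphism `X ×_Y Z ⟶ Z`; being integral, this
  -- morphism receives a map from the normalization, which is `Z`.
  let t : pullback (genericPointHom S) z ⟶ pullback h v :=
    pullback.lift ((pullbackSymmetry z (genericPointHom S)).inv ≫ uK ≫ pullback.fst _ _) r (by
      rw [← cancel_epi (pullbackSymmetry z (genericPointHom S)).hom, reassoc_of% hr, hvK,
        Category.assoc uK m, hm]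
      simp)
  have ht : t ≫ pullback.snd h v = r := pullback.lift_snd ..
  have ht' : t ≫ pullback.fst h v = _ := pullback.lift_fst ..
  let d := r.normalizationDesc t (pullback.snd h v) ht.symm
  have hd : d ≫ pullback.snd h v = r.fromNormalization := r.normalizationDesc_comp ..
  refine ⟨inv r.fromNormalization ≫ d ≫ pullback.fst h v, ?_, ?_⟩
  · rw [Category.assoc, Category.assoc, pullback.condition_assoc, reassoc_of% hd, hv]
    simp
  · have hr' : r ≫ inv r.fromNormalization = r.toNormalization := by
      rw [IsIso.comp_inv_eq, r.toNormalization_fromNormalization]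
    rw [← hr, Category.assoc, reassoc_of% hr', r.toNormalization_normalizationDesc_assoc,
      ht', Iso.hom_inv_id_assoc]

/-! ### The integral closure as a pseudo-Néron model -/

/-- The comparison map to the generic fibre is affine, so sections decide whether it is an
isomorphism. Both sides are the same localization of `Γ(X, U)`, between which there is only one
algebra map. -/
theorem isPullback_genericPointHom_of_isLocalization {S X XK : Scheme.{u}} [IsDedekindScheme S]
    {p : X ⟶ S} {j : XK ⟶ X} {a : XK ⟶ Spec S.functionField} [IsAffineHom j]
    (w : j ≫ p = a ≫ genericPointHom S)
    (H : ∀ x : X, ∃ (W : S.Opens) (U : X.Opens) (e : U ≤ p ⁻¹ᵁ W), IsAffineOpen W ∧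
      IsAffineOpen U ∧ x ∈ U ∧ @IsLocalization Γ(X, U) _
        ((nonZeroDivisors Γ(S, W)).map (p.appLE W U e).hom)
        Γ(XK, j ⁻¹ᵁ U) _ (j.app U).hom.toAlgebra) :
    IsPullback j a p (genericPointHom S) := by
  obtain ⟨t, rfl, rfl⟩ : ∃ t : XK ⟶ pullback p (genericPointHom S),
    t ≫ pullback.fst _ _ = j ∧ t ≫ pullback.snd _ _ = a := ⟨pullback.lift j a w, pullback.lift_fst .., pullback.lift_snd ..⟩
  have : IsAffineHom (pullback.fst p (genericPointHom S)) :=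
    isAffineHom_isStableUnderBaseChange.of_isPullback
      (IsPullback.of_hasPullback p (genericPointHom S)).flip inferInstance
  have : IsAffineHom t := .of_comp t (pullback.fst p (genericPointHom S))
  have : IsIso t := by
    refine IsZariskiLocalAtTarget.of_forall_exists_morphismRestrict (P := .isomorphisms _)
      fun y ↦ ?_
    obtain ⟨W, U, e, hW, hU, hy, hloc⟩ := H (pullback.fst p (genericPointHom S) y)
    refine ⟨_, hy, (isIso_morphismRestrict_iff_isIso_app t (hU.preimage _)).mpr ?_⟩
    have : Nonempty W := ⟨⟨_, e hy⟩⟩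
    have hloc' := isLocalization_app_of_isPullback_genericPointHom
      (.of_hasPullback p (genericPointHom S)) hW hU e
    let _ := ((pullback.fst p (genericPointHom S)).app U).hom.toAlgebra
    let _ : Algebra Γ(X, U) Γ(XK, t ⁻¹ᵁ pullback.fst p (genericPointHom S) ⁻¹ᵁ U) :=
      ((t ≫ pullback.fst p (genericPointHom S)).app U).hom.toAlgebra
    let M := (nonZeroDivisors Γ(S, W)).map (p.appLE W U e).hom
    have : IsLocalization M Γ(XK, t ⁻¹ᵁ pullback.fst p (genericPointHom S) ⁻¹ᵁ U) := hloc
    let f : Γ(pullback p (genericPointHom S), pullback.fst p (genericPointHom S) ⁻¹ᵁ U) →ₐ[Γ(X, U)]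
        Γ(XK, t ⁻¹ᵁ pullback.fst p (genericPointHom S) ⁻¹ᵁ U) :=
      { (t.app (pullback.fst p (genericPointHom S) ⁻¹ᵁ U)).hom with
        commutes' x := by
          simp only [RingHom.algebraMap_toAlgebra]
          rfl }
    have hf : f = IsLocalization.algEquiv M
        Γ(pullback p (genericPointHom S), pullback.fst p (genericPointHom S) ⁻¹ᵁ U)
        Γ(XK, t ⁻¹ᵁ pullback.fst p (genericPointHom S) ⁻¹ᵁ U) :=
      (IsLocalization.algHom_subsingleton M).elim _ _
    refine (ConcreteCategory.isIso_iff_bijective _).mpr ?_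
    change Function.Bijective f
    rw [hf]
    exact AlgEquiv.bijective _
  exact .of_iso_pullback ⟨w⟩ (asIso t) rfl rfl

theorem AlgebraicGeometry.IsAffineOpen.isLocallyIntegrallyClosed_of_smooth {X : Scheme.{u}}
    {F : CommRingCat.{u}} (hF : IsField F) (a : X ⟶ Spec F) [Smooth a] {U : X.Opens}
    (hU : IsAffineOpen U) : IsLocallyIntegrallyClosed Γ(X, U) := by
  let _ : Field F := hF.toField
  have h := (RingHom.Smooth.of_bijective
    (Scheme.ΓSpecIso F).symm.commRingCatIsoToRingEquiv.bijective).comp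
    (a.smooth_appLE (isAffineOpen_top _) hU (by simp))
  algebraize [(a.appLE ⊤ U (by simp)).hom.comp
    (Scheme.ΓSpecIso F).symm.commRingCatIsoToRingEquiv.toRingHom]
  have : Algebra.Smooth F Γ(X, U) := h
  exact .of_smooth F

/-- The integral closure of a finite type `S`-scheme in a smooth scheme finite over its generic fibre,
over small affine opens. -/
theorem normalization_app_properties {S XK YK Y : Scheme.{u}} [IsDedekindScheme S]
    (a : XK ⟶ Spec S.functionField) [Smooth a] {b : YK ⟶ Spec S.functionField} {f : XK ⟶ YK}
    [IsFinite f] {q : Y ⟶ S} [LocallyOfFiniteType q] {i : YK ⟶ Y} [IsAffineHom i]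
    (H : IsPullback i b q (genericPointHom S)) {W : S.Opens} {V : Y.Opens} (hW : IsAffineOpen W)
    [Nonempty W] (h : IsN2Domain Γ(S, W)) (hV : IsAffineOpen V) (e : V ≤ q ⁻¹ᵁ W)
    (e' : (f ≫ i).fromNormalization ⁻¹ᵁ V ≤ ((f ≫ i).fromNormalization ≫ q) ⁻¹ᵁ W) :
    ((f ≫ i).fromNormalization.app V).hom.Finite ∧
    IsLocallyIntegrallyClosed
      Γ((f ≫ i).normalization, (f ≫ i).fromNormalization ⁻¹ᵁ V) ∧
    (((f ≫ i).fromNormalization ≫ q).appLE W _ e').hom.Flat ∧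
    @IsLocalization Γ((f ≫ i).normalization, (f ≫ i).fromNormalization ⁻¹ᵁ V) _
      ((nonZeroDivisors Γ(S, W)).map (((f ≫ i).fromNormalization ≫ q).appLE W _ e').hom)
      Γ(XK, (f ≫ i) ⁻¹ᵁ V) _
      ((f ≫ i).toNormalization.appLE ((f ≫ i).fromNormalization ⁻¹ᵁ V) ((f ≫ i) ⁻¹ᵁ V)
        (by rw [← Scheme.Hom.comp_preimage, Scheme.Hom.toNormalization_fromNormalization])).hom.toAlgebra := by
  have := IsDedekindScheme.isDedekindDomain hW
  let A := Γ(Y, V)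
  let AK := Γ(YK, i ⁻¹ᵁ V)
  let B := Γ(XK, (f ≫ i) ⁻¹ᵁ V)
  let C := Γ((f ≫ i).normalization, (f ≫ i).fromNormalization ⁻¹ᵁ V)
  let _ : Algebra Γ(S, W) A := (q.appLE W V e).hom.toAlgebra
  let _ : Algebra A AK := (i.app V).hom.toAlgebra
  let _ : Algebra AK B := (f.app (i ⁻¹ᵁ V)).hom.toAlgebra
  let _ : Algebra A B := ((f ≫ i).app V).hom.toAlgebra
  let _ : Algebra A C := ((f ≫ i).fromNormalization.app V).hom.toAlgebra
  let _ : Algebra C B := ((f ≫ i).toNormalization.appLE _ ((f ≫ i) ⁻¹ᵁ V)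
    (by rw [← Scheme.Hom.comp_preimage, Scheme.Hom.toNormalization_fromNormalization])).hom.toAlgebra
  let _ : Algebra Γ(S, W) C :=
    (((f ≫ i).fromNormalization ≫ q).appLE W _ e').hom.toAlgebra
  have : IsScalarTower A AK B := .of_algebraMap_eq' (by
    simp only [RingHom.algebraMap_toAlgebra, Scheme.Hom.comp_app]
    rfl)
  have : IsScalarTower A C B := (f ≫ i).isScalarTower_normalization V
  have : IsScalarTower Γ(S, W) A C := .of_algebraMap_eq' (by
    change _ = (q.appLE W V e ≫ (f ≫ i).fromNormalization.app V).hom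
    rw [Scheme.Hom.app_eq_appLE, Scheme.Hom.appLE_comp_appLE]
    rfl)
  have : IsIntegralClosure C A B := (f ≫ i).isIntegralClosure_normalization hV
  have : Algebra.FiniteType Γ(S, W) A := q.finiteType_appLE hW hV e
  have : Module.Finite AK B := f.finite_app _ (hV.preimage i)
  have : IsLocalization (Algebra.algebraMapSubmonoid A (nonZeroDivisors Γ(S, W))) AK :=
    isLocalization_app_of_isPullback_genericPointHom H hW hV e
  have hB : IsLocallyIntegrallyClosed B :=
    ((hV.preimage i).preimage f).isLocallyIntegrallyClosed_of_smooth 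
      (isField_stalk_of_closure_mem_irreducibleComponents S _
        (by simp [irreducibleComponents_eq_singleton])) a
  obtain ⟨hfin, hnorm, hflat, hloc⟩ := IsIntegralClosure.properties_of_isN2Domain (A := A) (AK := AK) (C := C) h hB
  exact ⟨hfin, hnorm, hflat, hloc⟩

theorem exists_isAffineOpen_isNagataRing {S Y : Scheme.{u}} [IsDedekindScheme S]
    (hS : IsNagataScheme S) (q : Y ⟶ S) (y : Y) :
    ∃ (W : S.Opens) (V : Y.Opens), IsAffineOpen W ∧ IsAffineOpen V ∧ y ∈ V ∧ V ≤ q ⁻¹ᵁ W ∧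
      IsNagataRing Γ(S, W) := by
  obtain ⟨W, hW, hy, hn⟩ := hS (q y)
  obtain ⟨_, ⟨V, hV, rfl⟩, hyV, hVW⟩ := Y.isBasis_affineOpens.exists_subset_of_mem_open
    (show y ∈ q ⁻¹ᵁ W from hy) (q ⁻¹ᵁ W).2
  exact ⟨W, V, hW, hV, hyV, hVW, hn⟩

/-- The integral closure of a pseudo-Néron model in a smooth scheme finite over its generic fibre is
finite, and a normal pseudo-Néron model. -/
theorem isFinite_fromNormalization_and_isNormalPseudoNeronModel {S XK YK Y : Scheme.{u}}
    [IsDedekindScheme S] (hS : IsNagataScheme S) (a : XK ⟶ Spec S.functionField) [Smooth a]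
    (b : YK ⟶ Spec S.functionField) (f : XK ⟶ YK) [IsFinite f] (hf : f ≫ b = a) (q : Y ⟶ S)
    (i : YK ⟶ Y) [IsAffineHom i] (hY : IsPseudoNeronModel b q i) :
    IsFinite (f ≫ i).fromNormalization ∧
      IsNormalPseudoNeronModel a ((f ≫ i).fromNormalization ≫ q) (f ≫ i).toNormalization := by
  have := hY.locallyOfFiniteType
  have := hY.isSeparated
  have := hY.quasiCompact
  have := hY.isSeparated_generic
  have := hY.quasiCompact_generic
  let n := (f ≫ i).fromNormalization
  choose W V hW hV hx e hN using fun x ↦ exists_isAffineOpen_isNagataRing hS q (n x)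
  have (x : (f ≫ i).normalization) : Nonempty (W x) := ⟨⟨_, e x (hx x)⟩⟩
  have e' (x : (f ≫ i).normalization) : n ⁻¹ᵁ V x ≤ (n ≫ q) ⁻¹ᵁ W x := n.preimage_mono (e x)
  have key (x : (f ≫ i).normalization) := normalization_app_properties a hY.isPullback (hW x)
    (hN x).isN2Domain (hV x) (e x) (e' x)
  have hfin : IsFinite n := by
    refine (IsFinite.iff_isIntegralHom_and_locallyOfFiniteType _).mpr ⟨inferInstance, ?_⟩
    refine (HasRingHomProperty.iff_exists_appLE (P := @LocallyOfFiniteType)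
      (RingHom.finiteType_stableUnderComposition.stableUnderCompositionWithLocalizationAway
        RingHom.finiteType_holdsForLocalizationAway).1).mpr fun x ↦ ?_
    refine ⟨⟨V x, hV x⟩, ⟨n ⁻¹ᵁ V x, (hV x).preimage n⟩, hx x, le_rfl, ?_⟩
    rw [← Scheme.Hom.app_eq_appLE]
    exact (key x).1.finiteType
  refine ⟨hfin, ⟨?_, ?_, ?_, ?_, ?_, ?_, ?_, ?_, ?_⟩, ?_⟩
  · infer_instance
  · rw [← hf]
    infer_instance
  · rw [← hf]
    infer_instance
  · infer_instance
  · refine (HasRingHomProperty.iff_exists_appLE (P := @Flat)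
      (RingHom.Flat.stableUnderComposition.stableUnderCompositionWithLocalizationAway
        RingHom.Flat.holdsForLocalizationAway).1).mpr fun x ↦ ?_
    exact ⟨⟨W x, hW x⟩, ⟨n ⁻¹ᵁ V x, (hV x).preimage n⟩, hx x, e' x, (key x).2.2.1⟩
  · infer_instance
  · infer_instance
  · refine isPullback_genericPointHom_of_isLocalization ?_ fun x ↦ ?_
    · rw [Scheme.Hom.toNormalization_fromNormalization_assoc, Category.assoc, hY.isPullback.w,
        reassoc_of% hf]
    refine ⟨W x, n ⁻¹ᵁ V x, e' x, hW x, (hV x).preimage n, hx x, ?_⟩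
    have hpre : (f ≫ i).toNormalization ⁻¹ᵁ n ⁻¹ᵁ V x = (f ≫ i) ⁻¹ᵁ V x := by
      rw [← Scheme.Hom.comp_preimage, Scheme.Hom.toNormalization_fromNormalization]
    rw [Scheme.Hom.app_eq_appLE]
    -- The two preimages agree only propositionally; a variable `Q` allows substitution along
    -- `hpre`.
    have key' (Q : XK.Opens) (hQ : Q = (f ≫ i) ⁻¹ᵁ V x)
        (hle : Q ≤ (f ≫ i).toNormalization ⁻¹ᵁ n ⁻¹ᵁ V x) :
        @IsLocalization Γ((f ≫ i).normalization, n ⁻¹ᵁ V x) _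
          ((nonZeroDivisors Γ(S, W x)).map ((n ≫ q).appLE (W x) _ (e' x)).hom) Γ(XK, Q) _
          ((f ≫ i).toNormalization.appLE _ Q hle).hom.toAlgebra := by
      subst hQ
      exact (key x).2.2.2
    exact key' _ hpre le_rfl
  · exact hY.weakExtension.of_isIntegralHom n rfl
  · refine IsNormalScheme.of_forall_exists_isAffineOpen fun x ↦ ?_
    exact ⟨_, (hV x).preimage n, hx x, (key x).2.1⟩

theorem mainTheorem3 (S : Scheme.{u}) [IsDedekindScheme S] (hS : IsNagataScheme S)
    {XK YK Y : Scheme.{u}}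
    (a : XK ⟶ Spec S.functionField) [Smooth a]
    (b : YK ⟶ Spec S.functionField) [Smooth b] [IsSeparated b] [QuasiCompact b]
    (f : XK ⟶ YK) [IsFinite f] (hf : f ≫ b = a)
    (q : Y ⟶ S) (i : YK ⟶ Y) (hY : IsNormalPseudoNeronModel b q i) :
    -- existence of a normal pseudo-Néron model
    (∃ (X : Scheme.{u}) (p : X ⟶ S) (j : XK ⟶ X), IsNormalPseudoNeronModel a p j) ∧
    -- the integral closure of `Y` in `X_K` is finite over `Y` and is such a model
    (∃ (_ : QuasiCompact (f ≫ i)) (_ : QuasiSeparated (f ≫ i)),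
      IsFinite (f ≫ i).fromNormalization ∧
      IsNormalPseudoNeronModel a ((f ≫ i).fromNormalization ≫ q) (f ≫ i).toNormalization) ∧
    -- the weak extension property passes along finite morphisms
    (∀ (X' Y' : Scheme.{u}) (p' : X' ⟶ S) (q' : Y' ⟶ S) (h : X' ⟶ Y') [IsFinite h],
      h ≫ q' = p' → WeakExtensionProperty q' → WeakExtensionProperty p') := by
  -- `i` is a base change of `Spec K ⟶ S`, which is affine. Hence `f ≫ i` is affine, so
  -- quasi-compact and quasi-separated, as the normalization requires.
  have : IsAffineHom i := isAffineHom_isStableUnderBaseChange.of_isPullback hY.isPullback.flip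
    inferInstance
  have h := isFinite_fromNormalization_and_isNormalPseudoNeronModel hS a b f hf q i
    hY.toIsPseudoNeronModel
  exact ⟨⟨_, _, _, h.2⟩, ⟨inferInstance, inferInstance, h⟩,
    fun _ _ _ _ h _ hp hq ↦ hq.of_isIntegralHom h hp⟩
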